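/- Let $S=\{2^p3^q5^l : p,q,l\in\mathbb{N}_0\}$ be the set of $5$-smooth (Hamming) numbers, let $N_{2,3,5}(x)$ be the number of triples $(p,q,l)\in\mathbb{N}_0^3$ with $2^p3^q5^l\le x$ (equivalently, the number of elements of $S$ that are $\le x$), and let $\chi_S(x)=1$ if $x\in S$ and $\chi_S(x)=0$ otherwise. For real $t$ with fractional part $\{t\}$ put $B_1^*(\{t\})=\{t\}-\frac12$ if $t\notin\mathbb{Z}$ and $B_1^*(\{t\})=0$ if $t\in\mathbb{Z}$. For $x\ge1$, $R>0$ and $\{a,b,c\}=\{2,3,5\}$ define the truncated series $$C_{a,b}(x;R)=\sum_{k=1}^{\lfloor R\log a\rfloor}\frac{\cos\left(2\pi k\frac{\log x-\frac12\log b}{\log a}\right)}{k\sin\left(\frac{\pi k\log b}{\log a}\right)}+\sum_{k=1}^{\lfloor R\log b\rfloor}\frac{\cos\left(2\pi k\frac{\log x-\frac12\log a}{\log b}\right)}{k\sin\left(\frac{\pi k\log a}{\log b}\right)},$$ $$D_{a;b,c}(x;R)=\sum_{k=1}^{\lfloor R\log a\rfloor}\left(\frac{\sin\left(2\pi k\frac{\log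 x+\frac12\log b-\frac12\log c}{\log a}\right)}{k\sin\left(\frac{\pi k\log b}{\log a}\right)\sin\left(\frac{\pi k\log c}{\log a}\right)}+\frac{\sin\left(2\pi k\frac{\log x-\frac12\log b+\frac12\log c}{\log a}\right)}{k\sin\left(\frac{\pi k\log b}{\log a}\right)\sin\left(\frac{\pi k\log c}{\log a}\right)}\right).$$ Then there is a sequence of real numbers $R_j\to\infty$, independent of $x$, such that for every real number $x\ge1$ the limits $$C_{2,3}(x)=\lim_{j\to\infty}C_{2,3}(x;R_j),\quad C_{3,5}(x)=\lim_{j\to\infty}C_{3,5}(x;R_j),\quad C_{5,2}(x)=\lim_{j\to\infty}C_{5,2}(x;R_j),$$ $$D(x)=\lim_{j\to\infty}\bigl(D_{2;3,5}(x;R_j)+D_{3;2,5}(x;R_j)+D_{5;2,3}(x;R_j)\bigr)$$ exist, and $$\begin{aligned}N_{2,3,5}(x)&=\frac{(\log x)^3}{6\log2\log3\log5}+\frac{(\log x)^2}{4\log2\log3}+\frac{(\log x)^2}{4\log2\log5}+\frac{(\log x)^2}{4\log3\log5}+\frac{\log x}{4\log2}+\frac{\log x}{4\log3}+\frac{\log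 x}{4\log5}\\&\quad+\frac{\log2\log x}{12\log3\log5}+\frac{\log3\log x}{12\log2\log5}+\frac{\log5\log x}{12\log2\log3}\\&\quad+\frac{\log2}{24\log3}+\frac{\log2}{24\log5}+\frac{\log3}{24\log2}+\frac{\log3}{24\log5}+\frac{\log5}{24\log2}+\frac{\log5}{24\log3}+\frac18\\&\quad-B_1^*\left(\left\{\frac{\log x}{\log2}\right\}\right)-B_1^*\left(\left\{\frac{\log x}{\log3}\right\}\right)-B_1^*\left(\left\{\frac{\log x}{\log5}\right\}\right)\\&\quad-\frac1{4\pi}C_{2,3}(x)-\frac1{4\pi}C_{3,5}(x)-\frac1{4\pi}C_{5,2}(x)-\frac1{8\pi}D(x)+\frac12\chi_S(x).\end{aligned}$$ -/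

import Mathlib

open Filter Topology

noncomputable section

/-- The set `S_{a,b,c}` of natural numbers of the form `a^p * b^q * c^l`, `p, q, l ≥ 0`. -/
def smoothSet (a b c : ℕ) : Set ℕ :=
  {n | ∃ p q l : ℕ, n = a ^ p * b ^ q * c ^ l}

/-- `N_{a,b,c}(x)`: the number of triples of exponents `(p, q, l)` with `a^p b^q c^l ≤ x`. -/
def smoothCount (a b c : ℕ) (x : ℝ) : ℕ :=
  {t : ℕ × ℕ × ℕ | (a : ℝ) ^ t.1 * (b : ℝ) ^ t.2.1 * (c : ℝ) ^ t.2.2 ≤ x}.ncard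

open Classical in
/-- The characteristic function of `S_{a,b,c}`, as a function of a real variable. -/
def smoothChi (a b c : ℕ) (x : ℝ) : ℝ :=
  if ∃ n ∈ smoothSet a b c, (n : ℝ) = x then 1 else 0

open Classical in
/-- `B₁^*({t})`: equal to `{t} - 1/2` if `t` is not an integer and to `0` if `t` is an integer. -/
def bernoulliOneStar (t : ℝ) : ℝ :=
  if ∃ m : ℤ, (m : ℝ) = t then 0 else Int.fract t - 1 / 2

/-- The `k`-th term
`cos (2πk (log x - (1/2) log b) / log a) / (k sin (πk log b / log a))`. -/
def cosTerm (a b : ℕ) (x : ℝ) (k : ℕ) : ℝ :=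
  Real.cos (2 * Real.pi * k * ((Real.log x - 1 / 2 * Real.log b) / Real.log a)) /
    (k * Real.sin (Real.pi * k * Real.log b / Real.log a))

/-- The truncation at height `R` of the cosine series attached to the pair `a, b`: the terms with
denominator `log a` are summed for `1 ≤ k ≤ R log a`, those with denominator `log b` are summed
for `1 ≤ k ≤ R log b`. -/
def cosPairSum (a b : ℕ) (x R : ℝ) : ℝ :=
  (∑ k ∈ Finset.Icc 1 ⌊R * Real.log a⌋₊, cosTerm a b x k) +
    ∑ k ∈ Finset.Icc 1 ⌊R * Real.log b⌋₊, cosTerm b a x k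

/-- The `k`-th term of the sine series with denominator `log a`. -/
def sinTerm (a b c : ℕ) (x : ℝ) (k : ℕ) : ℝ :=
  Real.sin (2 * Real.pi * k *
      ((Real.log x + 1 / 2 * Real.log b - 1 / 2 * Real.log c) / Real.log a)) /
    (k * Real.sin (Real.pi * k * Real.log b / Real.log a) *
      Real.sin (Real.pi * k * Real.log c / Real.log a)) +
  Real.sin (2 * Real.pi * k *
      ((Real.log x - 1 / 2 * Real.log b + 1 / 2 * Real.log c) / Real.log a)) /
    (k * Real.sin (Real.pi * k * Real.log b / Real.log a) *
      Real.sin (Real.pi * k * Real.log c / Real.log a))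

/-- The truncation at height `R` (that is, to `1 ≤ k ≤ R log a`) of the sine series with
denominator `log a`. -/
def sinSum (a b c : ℕ) (x R : ℝ) : ℝ :=
  ∑ k ∈ Finset.Icc 1 ⌊R * Real.log a⌋₊, sinTerm a b c x k

end

/-! Write a, b, c for log 2, log 3, log 5 and u = log x. Count the lattice points with pa + qb + lc
≤ u, giving those on the boundary weight 1/2. Formally this count is the sum of all residues of
e^{vz} / (z · 2sinh(az/2) · 2sinh(bz/2) · 2sinh(cz/2)) at v = u + (a+b+c)/2. The pole of order four
at 0 gives a cubic polynomial in v. The poles 2πik/a, 2πik/b, 2πik/c are simple because the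
logarithms have irrational ratios, and they give the series. Cutting the three series at R log 2, R
log 3, R log 5 keeps exactly the poles with |z| < 2πR.

Two facts make this rigorous. Decay: for |v| < (a+b+c)/2 the sinh product dominates e^{vz}, so the
integrals over circles that keep away from the poles tend to 0, and with them the residue sums
(`tendsto_sum_sinhResidue`). Difference equation: passing from v - a/2 to v + a/2 produces a factor
2sinh(az/2), which removes one factor of the kernel; so the difference of two three-factor sums is a
two-factor sum, exactly and for each R (`threeSum_sub`, then `twoSum_sub`, `oneSum_sub`). Stepping
down from u + (a+b+c)/2 by multiples of a, one lands in the range of decay, and the collected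
differences have the lower-dimensional counts as limits (`tendsto_threeSum`). At the lowest level
the endpoint v = -a/2 can occur; there the one-factor sum is exactly -1/2, which is the source of
the boundary weight 1/2 and hence of the term with χ_S.

A trigonometric identity (`residuePairThree_eq`) splits each three-factor residue into a sawtooth
term, two cosine terms and a sine term. The sawtooth series are one-factor sums. The cosine series
are, up to a polynomial and a constant factor, two-factor sums at the reflected argument u -
(a+b)/2, so they converge on their own (`exists_tendsto_twoSum_sub`). The combined sine series then
converges because everything else does. Suitable radii come from a pigeonhole argument
(`exists_forall_le_abs_sub`). -/

noncomputable section

/-! ### Residue theorem on a disc -/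

/-- The integral over a circle vanishes if the integrand is holomorphic on the closed disc up to
finitely many removable singularities in the open disc. -/
theorem circleIntegral_eq_zero_of_removable {T : ℝ} (hT : 0 < T) (Q : Finset ℂ) (g : ℂ → ℂ)
    (hQ : ∀ q ∈ Q, ‖q‖ < T)
    (hg : ∀ z ∈ Metric.closedBall (0 : ℂ) T, z ∉ Q → DifferentiableAt ℂ g z)
    (hlim : ∀ q ∈ Q, Tendsto (fun z => (z - q) * g z) (𝓝[≠] q) (𝓝 0)) :
    (∮ z in C(0, T), g z) = 0 := by
  classical
  induction Q using Finset.induction_on generalizing g with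
  | empty =>
    refine Complex.circleIntegral_eq_zero_of_differentiable_on_off_countable hT.le
      Set.countable_empty (fun z hz => ?_) (fun z hz => ?_)
    · exact (hg z hz (by simp)).continuousAt.continuousWithinAt
    · exact hg z (Metric.ball_subset_closedBall hz.1) (by simp)
  | insert q Q hq ih =>
    -- Riemann's theorem: fill in one singularity by its limit and pass to the smaller set. The
    -- circle does not meet q, so the integral is unchanged.
    set g₁ : ℂ → ℂ := Function.update g q (limUnder (𝓝[≠] q) g) with hg₁
    have hqT : ‖q‖ < T := hQ q (by simp)
    have hcongr : (∮ z in C(0, T), g z) = ∮ z in C(0, T), g₁ z := by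
      refine circleIntegral.integral_congr hT.le (fun z hz => ?_)
      have : z ≠ q := by
        rintro rfl
        simp at hz
        linarith
      simp [hg₁, this]
    have heq : ∀ z, z ≠ q → g₁ =ᶠ[𝓝 z] g := fun z hz => by
      filter_upwards [isOpen_ne.mem_nhds hz] with w hw
      simp [hg₁, hw]
    rw [hcongr]
    refine ih g₁ (fun p hp => hQ p (by simp [hp])) (fun z hz hzQ => ?_) (fun p hp => ?_)
    · by_cases hzq : z = q
      · subst hzq
        set s : Set ℂ := Metric.ball 0 T ∩ (Q : Set ℂ)ᶜ with hs
        have hso : s ∈ 𝓝 z := by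
          refine (Metric.isOpen_ball.inter Q.finite_toSet.isClosed.isOpen_compl).mem_nhds ?_
          exact ⟨by simpa using hqT, by simpa using hzQ⟩
        have hd : DifferentiableOn ℂ g (s \ {z}) := fun w hw =>
          (hg w (Metric.ball_subset_closedBall hw.1.1) (by
            have h1 := hw.1.2
            have h2 := hw.2
            simp at h1 h2 ⊢
            exact ⟨h2, h1⟩)).differentiableWithinAt
        have hlo : (fun w => g w - g z) =o[𝓝[≠] z] fun w => (w - z)⁻¹ := by
          rw [Asymptotics.isLittleO_iff_tendsto']
          · have h1 := hlim z (by simp)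
            have h2 : Tendsto (fun w => (w - z) * g z) (𝓝[≠] z) (𝓝 0) := by
              have : Tendsto (fun w => (w - z) * g z) (𝓝 z) (𝓝 ((z - z) * g z)) :=
                Continuous.tendsto (by fun_prop) z
              simpa using this.mono_left nhdsWithin_le_nhds
            have h3 := h1.sub h2
            rw [sub_zero] at h3
            refine h3.congr (fun w => ?_)
            rw [div_inv_eq_mul]; ring
          · filter_upwards [self_mem_nhdsWithin] with w hw h0
            exact absurd (inv_eq_zero.1 h0) (sub_ne_zero.2 hw)
        exact (Complex.differentiableOn_update_limUnder_of_isLittleO hso hd hlo).differentiableAt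
          hso
      · exact (hg z hz (by simp [hzq, hzQ])).congr_of_eventuallyEq (heq z hzq)
    · have hpq : p ≠ q := by rintro rfl; exact hq hp
      refine (hlim p (by simp [hp])).congr' ?_
      filter_upwards [(heq p hpq).filter_mono nhdsWithin_le_nhds] with w hw
      rw [hw]

/-- The residue theorem on a disc for finitely many simple poles away from the centre and a pole of
order at most four at the centre. -/
theorem circleIntegral_eq_sum_residues {κ : Type*} {T : ℝ} (hT : 0 < T) (s : Finset κ)
    (p : κ → ℂ) (c : κ → ℂ) (f : ℂ → ℂ) (a₀ a₁ a₂ a₃ : ℂ)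
    (hinj : Set.InjOn p s) (hp0 : ∀ i ∈ s, p i ≠ 0) (hpT : ∀ i ∈ s, ‖p i‖ < T)
    (hf : ∀ z ∈ Metric.closedBall (0 : ℂ) T, z ≠ 0 → (∀ i ∈ s, z ≠ p i) → DifferentiableAt ℂ f z)
    (hc : ∀ i ∈ s, Tendsto (fun z => (z - p i) * f z) (𝓝[≠] (p i)) (𝓝 (c i)))
    (h0 : Tendsto (fun z => (z ^ 4 * f z - (a₀ + a₁ * z + a₂ * z ^ 2 + a₃ * z ^ 3)) / z ^ 3)
      (𝓝[≠] 0) (𝓝 0)) :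
    (∮ z in C(0, T), f z) = 2 * Real.pi * Complex.I * (a₃ + ∑ i ∈ s, c i) := by
  classical
  set q : ℂ → ℂ := fun z => a₀ * z ^ (-4 : ℤ) + a₁ * z ^ (-3 : ℤ) + a₂ * z ^ (-2 : ℤ) with hq
  set r : ℂ → ℂ := fun z => ∑ i ∈ s, c i * (z - p i)⁻¹ with hr
  -- Subtract all principal parts. What is left has removable singularities; at 0 the assumption
  -- `h0` says exactly that z · (f - principal part) tends to 0. Of the subtracted terms, only those
  -- in z⁻¹ and (z - p i)⁻¹ have a nonzero integral.
  set g : ℂ → ℂ := fun z => f z - (q z + a₃ * z⁻¹ + r z) with hg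
  have hqd : ∀ z, z ≠ 0 → DifferentiableAt ℂ (fun z => q z + a₃ * z⁻¹) z := fun z hz => by
    refine (((DifferentiableAt.const_mul ?_ _).add (DifferentiableAt.const_mul ?_ _)).add
      (DifferentiableAt.const_mul ?_ _)).add (DifferentiableAt.const_mul ?_ _)
    · exact (differentiableAt_zpow.2 (Or.inl hz))
    · exact (differentiableAt_zpow.2 (Or.inl hz))
    · exact (differentiableAt_zpow.2 (Or.inl hz))
    · exact differentiableAt_inv hz
  have hrd : ∀ t ⊆ s, ∀ z, (∀ i ∈ t, z ≠ p i) →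
      DifferentiableAt ℂ (fun z => ∑ i ∈ t, c i * (z - p i)⁻¹) z := fun t _ z hz => by
    refine DifferentiableAt.fun_sum (fun i hi => DifferentiableAt.const_mul ?_ _)
    exact (differentiableAt_id.sub_const _).inv (sub_ne_zero.2 (hz i hi))
  have hnear : ∀ (h : ℂ → ℂ) (w : ℂ), ContinuousAt h w →
      Tendsto (fun z => (z - w) * h z) (𝓝[≠] w) (𝓝 0) := fun h w hh => by
    have h1 : ContinuousAt (fun z => (z - w) * h z) w := by fun_prop
    have h2 := h1.tendsto.mono_left (nhdsWithin_le_nhds (s := {w}ᶜ))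
    simpa using h2
  have hzero : (∮ z in C(0, T), g z) = 0 := by
    refine circleIntegral_eq_zero_of_removable hT (insert 0 (s.image p)) g ?_ ?_ ?_
    · intro z hz
      rcases Finset.mem_insert.1 hz with rfl | hz
      · simpa using hT
      · obtain ⟨i, hi, rfl⟩ := Finset.mem_image.1 hz
        exact hpT i hi
    · intro z hz hzQ
      simp only [Finset.mem_insert, Finset.mem_image, not_or, not_exists, not_and] at hzQ
      have hne : ∀ i ∈ s, z ≠ p i := fun i hi h => hzQ.2 i hi h.symm
      exact (hf z hz hzQ.1 hne).sub ((hqd z hzQ.1).add (hrd s subset_rfl z hne))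
    · intro w hw
      rcases Finset.mem_insert.1 hw with rfl | hw
      · have h1 := hnear r 0 (hrd s subset_rfl 0 (fun i hi => (hp0 i hi).symm)).continuousAt
        have h2 := h0.sub h1
        rw [sub_zero] at h2
        refine h2.congr' ?_
        filter_upwards [self_mem_nhdsWithin] with z hz
        have hz' : z ≠ 0 := hz
        simp only [hg, hq, zpow_neg]
        norm_cast
        field_simp
        ring
      · obtain ⟨i, hi, rfl⟩ := Finset.mem_image.1 hw
        have hsum : ∀ z, r z = c i * (z - p i)⁻¹ + ∑ j ∈ s.erase i, c j * (z - p j)⁻¹ :=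
          fun z => (Finset.add_sum_erase s _ hi).symm
        have h1 := hnear (fun z => q z + a₃ * z⁻¹) (p i) (hqd _ (hp0 i hi)).continuousAt
        have h2 := hnear (fun z => ∑ j ∈ s.erase i, c j * (z - p j)⁻¹) (p i)
          (hrd _ (s.erase_subset i) _ (fun j hj h =>
            (Finset.mem_erase.1 hj).1 (hinj (Finset.mem_erase.1 hj).2 hi h.symm))).continuousAt
        have h3 := (((hc i hi).sub_const (c i)).sub h1).sub h2
        simp only [sub_self] at h3
        refine h3.congr' ?_
        filter_upwards [self_mem_nhdsWithin] with z hz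
        have hz' : z - p i ≠ 0 := sub_ne_zero.2 hz
        simp only [hg, hsum]
        field_simp
        ring
  have hTne : T ≠ 0 := hT.ne'
  have hcont : ∀ h : ℂ → ℂ, (∀ z ∈ Metric.sphere (0 : ℂ) T, DifferentiableAt ℂ h z) →
      CircleIntegrable h 0 T := fun h hh =>
    ContinuousOn.circleIntegrable hT.le
      (fun z hz => (hh z hz).continuousAt.continuousWithinAt)
  have hs0 : ∀ z ∈ Metric.sphere (0 : ℂ) T, z ≠ 0 := by
    rintro z hz rfl
    simp at hz
    exact hTne hz.symm
  have hsp : ∀ z ∈ Metric.sphere (0 : ℂ) T, ∀ i ∈ s, z ≠ p i := by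
    rintro z hz i hi rfl
    have := hpT i hi
    simp at hz
    linarith
  have hIf : CircleIntegrable f 0 T := hcont f fun z hz =>
    hf z (Metric.sphere_subset_closedBall hz) (hs0 z hz) (hsp z hz)
  have hIq : CircleIntegrable (fun z => q z + a₃ * z⁻¹ + r z) 0 T := hcont _ fun z hz =>
    (hqd z (hs0 z hz)).add (hrd s subset_rfl z (hsp z hz))
  have hsplit := circleIntegral.integral_sub hIf hIq
  rw [show (∮ z in C(0, T), f z - (q z + a₃ * z⁻¹ + r z)) = 0 from hzero, eq_comm,
    sub_eq_zero] at hsplit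
  rw [hsplit]
  have hz1 : ∀ n : ℤ, CircleIntegrable (fun z : ℂ => z ^ n) 0 T := fun n => hcont _ fun z hz =>
    differentiableAt_zpow.2 (Or.inl (hs0 z hz))
  have hz2 : CircleIntegrable (fun z : ℂ => z⁻¹) 0 T := hcont _ fun z hz =>
    differentiableAt_inv (hs0 z hz)
  have hz3 : ∀ i ∈ s, CircleIntegrable (fun z : ℂ => (z - p i)⁻¹) 0 T := fun i hi =>
    hcont _ fun z hz => (differentiableAt_id.sub_const _).inv (sub_ne_zero.2 (hsp z hz i hi))
  have hcm : ∀ (a : ℂ) (h : ℂ → ℂ), CircleIntegrable h 0 T →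
      CircleIntegrable (fun z => a * h z) 0 T := fun a _ hh => hh.const_smul (a := a)
  have hint : ∀ n : ℤ, n ≠ -1 → (∮ z in C(0, T), z ^ n) = 0 := fun n hn => by
    simpa using circleIntegral.integral_sub_zpow_of_ne hn 0 0 T
  have hinv : (∮ z in C(0, T), z⁻¹) = 2 * Real.pi * Complex.I := by
    simpa using circleIntegral.integral_sub_inv_of_mem_ball (c := 0) (w := 0) (R := T)
      (by simpa using hT)
  have hsumI : (∮ z in C(0, T), r z) = ∑ i ∈ s, c i * (2 * Real.pi * Complex.I) := by
    simp only [hr]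
    rw [circleIntegral.integral_fun_sum (fun i hi => hcm _ _ (hz3 i hi))]
    refine Finset.sum_congr rfl (fun i hi => ?_)
    rw [circleIntegral.integral_const_mul,
      circleIntegral.integral_sub_inv_of_mem_ball (by simpa using hpT i hi)]
  have e1 := circleIntegral.integral_add (((hcm a₀ _ (hz1 (-4))).add (hcm a₁ _ (hz1 (-3)))).add
    (hcm a₂ _ (hz1 (-2)))|>.add (hcm a₃ _ hz2))
    (hcont r fun z hz => hrd s subset_rfl z (hsp z hz))
  have e2 := circleIntegral.integral_add (((hcm a₀ _ (hz1 (-4))).add (hcm a₁ _ (hz1 (-3)))).add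
    (hcm a₂ _ (hz1 (-2)))) (hcm a₃ _ hz2)
  have e3 := circleIntegral.integral_add ((hcm a₀ _ (hz1 (-4))).add (hcm a₁ _ (hz1 (-3))))
    (hcm a₂ _ (hz1 (-2)))
  have e4 := circleIntegral.integral_add (hcm a₀ _ (hz1 (-4))) (hcm a₁ _ (hz1 (-3)))
  simp only [Pi.add_apply] at e1 e2 e3 e4
  simp only [hq]
  rw [e1, e2, e3, e4, hsumI]
  simp only [circleIntegral.integral_const_mul, hinv]
  rw [hint _ (by norm_num), hint _ (by norm_num), hint _ (by norm_num), ← Finset.sum_mul]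
  ring

/-! ### Lower bound for sinh on circles -/

/-- On circles `‖z‖ = T` that stay away from the zeros of `sinh (a z / 2)`, this function grows like
`exp (a |Re z| / 2)`. -/
theorem exists_mul_exp_le_norm_two_mul_sinh {a κ : ℝ} (ha : 0 < a) (hκ : 0 < κ) :
    ∃ m : ℝ, 0 < m ∧ ∀ T : ℝ, 1 ≤ T → a / κ ≤ T → κ ≤ |Real.sin (a * T / 2)| →
      ∀ z : ℂ, ‖z‖ = T → m * Real.exp (a * |z.re| / 2) ≤ ‖2 * Complex.sinh (a * z / 2)‖ := by
  have hea : Real.exp (-a) < 1 := by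
    rw [Real.exp_lt_one_iff]; linarith
  -- The first constant serves |Re z| ≥ 1, where one exponential dominates the other. The second
  -- serves |Re z| < 1, where exp(a|Re z|/2) is at most exp(a/2) and a bound by κ suffices.
  refine ⟨min (1 - Real.exp (-a)) (κ * Real.exp (-(a / 2))),
    lt_min (by linarith) (by positivity), fun T hT1 hTa hsin z hz => ?_⟩
  have hre : (a * z / 2 : ℂ).re = a * z.re / 2 := by
    rw [show (a * z / 2 : ℂ) = ((a / 2 : ℝ) : ℂ) * z by push_cast; ring, Complex.re_ofReal_mul]
    ring
  have him : (a * z / 2 : ℂ).im = a * z.im / 2 := by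
    rw [show (a * z / 2 : ℂ) = ((a / 2 : ℝ) : ℂ) * z by push_cast; ring, Complex.im_ofReal_mul]
    ring
  rcases le_or_gt 1 |z.re| with hx | hx
  · refine (mul_le_mul_of_nonneg_right (min_le_left _ _) (Real.exp_nonneg _)).trans ?_
    have h1 : ‖2 * Complex.sinh (a * z / 2)‖ ≥
        |Real.exp (a * z.re / 2) - Real.exp (-(a * z.re / 2))| := by
      rw [Complex.two_sinh]
      refine le_trans (le_of_eq ?_) (abs_norm_sub_norm_le _ _)
      rw [Complex.norm_exp, Complex.norm_exp, Complex.neg_re, hre]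
    refine le_trans ?_ h1
    have h2 : |Real.exp (a * z.re / 2) - Real.exp (-(a * z.re / 2))| ≥
        Real.exp (a * |z.re| / 2) - Real.exp (-(a * |z.re| / 2)) := by
      rcases abs_cases z.re with ⟨h, -⟩ | ⟨h, -⟩
      · rw [h]; exact le_abs_self _
      · rw [h, abs_sub_comm]
        refine le_trans (le_of_eq ?_) (le_abs_self _)
        congr 2 <;> ring
    refine le_trans ?_ h2
    have h3 : Real.exp (-(a * |z.re| / 2)) ≤ Real.exp (-a) * Real.exp (a * |z.re| / 2) := by
      rw [← Real.exp_add]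
      apply Real.exp_le_exp.2
      nlinarith
    linarith
  · refine (mul_le_mul_of_nonneg_right (min_le_right _ _) (Real.exp_nonneg _)).trans ?_
    have h1 : κ * Real.exp (-(a / 2)) * Real.exp (a * |z.re| / 2) ≤ κ := by
      rw [mul_assoc, ← Real.exp_add]
      refine mul_le_of_le_one_right hκ.le (Real.exp_le_one_iff.2 ?_)
      nlinarith
    refine h1.trans ?_
    have h2 : |Real.sin (a * z.im / 2)| ≤ ‖Complex.sinh (a * z / 2)‖ := by
      refine le_trans ?_ (Complex.abs_im_le_norm _)
      rw [← Complex.re_add_im (a * z / 2 : ℂ), Complex.sinh_add, Complex.sinh_mul_I,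
        Complex.cosh_mul_I, hre, him]
      rw [← Complex.ofReal_sin, ← Complex.ofReal_cos, ← Complex.ofReal_sinh,
        ← Complex.ofReal_cosh]
      have : ((Real.sinh (a * z.re / 2) : ℂ) * (Real.cos (a * z.im / 2) : ℂ) +
          (Real.cosh (a * z.re / 2) : ℂ) * ((Real.sin (a * z.im / 2) : ℂ) * Complex.I)).im =
          Real.cosh (a * z.re / 2) * Real.sin (a * z.im / 2) := by
        simp [Complex.add_im, Complex.mul_im, -Complex.ofReal_sin, -Complex.ofReal_cos,
          -Complex.ofReal_sinh, -Complex.ofReal_cosh]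
      rw [this, abs_mul]
      refine le_mul_of_one_le_left (abs_nonneg _) ?_
      rw [abs_of_pos (Real.cosh_pos _)]
      exact Real.one_le_cosh _
    -- Near the imaginary axis |Im z| is close to T, and the sine is 1-Lipschitz, so |sin(a Im z/2)|
    -- inherits the lower bound at T. The loss is at most κ/2, since T² - (Im z)² = (Re z)² ≤ 1 and
    -- a ≤ κT; the factor 2 in 2sinh compensates for it.
    have h3 : |Real.sin (a * T / 2)| ≤ |Real.sin (a * z.im / 2)| + a / 2 * (T - |z.im|) := by
      have hs : |Real.sin (a * z.im / 2)| = |Real.sin (a * |z.im| / 2)| := by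
        rcases abs_cases z.im with ⟨h, -⟩ | ⟨h, -⟩
        · rw [h]
        · rw [h, show a * -z.im / 2 = -(a * z.im / 2) by ring, Real.sin_neg, abs_neg]
      have hle : |z.im| ≤ T := hz ▸ Complex.abs_im_le_norm z
      have hl := Real.abs_sin_sub_sin_le (a * T / 2) (a * |z.im| / 2)
      rw [show a * T / 2 - a * |z.im| / 2 = a / 2 * (T - |z.im|) by ring,
        abs_of_nonneg (a := a / 2 * (T - |z.im|)) (by
          have := sub_nonneg.2 hle
          positivity)] at hl
      have := abs_sub_abs_le_abs_sub (Real.sin (a * T / 2)) (Real.sin (a * |z.im| / 2))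
      rw [hs]
      linarith
    have h4 : T * (T - |z.im|) ≤ 1 := by
      have hsq : T ^ 2 = z.re ^ 2 + z.im ^ 2 := by
        rw [← hz, Complex.sq_norm, Complex.normSq_apply]; ring
      have h5 : z.re ^ 2 ≤ 1 := by
        rw [← sq_abs]; nlinarith [abs_nonneg z.re]
      have hle : |z.im| ≤ T := hz ▸ Complex.abs_im_le_norm z
      nlinarith [sq_abs z.im, abs_nonneg z.im]
    have h5 : a / 2 * (T - |z.im|) ≤ κ / 2 := by
      have : a ≤ κ * T := by
        rw [div_le_iff₀ hκ] at hTa; linarith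
      have hle : |z.im| ≤ T := hz ▸ Complex.abs_im_le_norm z
      nlinarith [mul_le_mul_of_nonneg_right this (sub_nonneg.2 hle)]
    rw [norm_mul]
    simp only [Complex.norm_ofNat]
    linarith

theorem two_mul_sinh_eq_zero_iff {a : ℝ} (ha : 0 < a) (z : ℂ) :
    2 * Complex.sinh (a * z / 2) = 0 ↔ ∃ n : ℤ, z = 2 * Real.pi * n * Complex.I / a := by
  have ha' : (a : ℂ) ≠ 0 := by exact_mod_cast ha.ne'
  have h1 : Complex.sinh (a * z / 2) = 0 ↔ Complex.sin (a * z / 2 * Complex.I) = 0 := by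
    rw [Complex.sin_mul_I]; simp
  rw [mul_eq_zero, or_iff_right two_ne_zero, h1, Complex.sin_eq_zero_iff]
  constructor
  · rintro ⟨k, hk⟩
    refine ⟨-k, ?_⟩
    push_cast
    field_simp
    linear_combination (-2 * Complex.I) * hk + (a * z : ℂ) * Complex.I_sq
  · rintro ⟨n, rfl⟩
    refine ⟨-n, ?_⟩
    push_cast
    field_simp
    linear_combination (n : ℂ) * Complex.I_sq

/-! ### The kernel, its poles and its residues -/

/-- The kernel `e^{vz} / (z ∏ 2 sinh (αᵢ z / 2))`. -/
def sinhKernel {ι : Type*} [Fintype ι] (α : ι → ℝ) (v : ℝ) (z : ℂ) : ℂ :=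
  Complex.exp (v * z) / (z * ∏ i, (2 * Complex.sinh (α i * z / 2)))

/-- The zero `2πin/a` of `sinh (a z / 2)`. -/
def sinhPole (a : ℝ) (n : ℤ) : ℂ := 2 * Real.pi * n * Complex.I / a

/-- The residue of `sinhKernel α v` at `2πin/αᵢ`. -/
def sinhResidue {ι : Type*} [Fintype ι] [DecidableEq ι] (α : ι → ℝ) (v : ℝ) (i : ι) (n : ℤ) : ℂ :=
  Complex.exp (v * sinhPole (α i) n) / (sinhPole (α i) n *
    ((α i * Complex.cosh (α i * sinhPole (α i) n / 2)) *
      ∏ j ∈ Finset.univ.erase i, (2 * Complex.sinh (α j * sinhPole (α i) n / 2))))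

/-- The pole is simple: the factor with index i has derivative αᵢ cosh ≠ 0 there, because cosh² = 1
+ sinh², and irrationality of the ratios keeps the other factors from vanishing. -/
theorem tendsto_sub_mul_sinhKernel {ι : Type*} [Fintype ι] [DecidableEq ι] (α : ι → ℝ)
    (hα : ∀ i, 0 < α i)
    (hirr : ∀ i j, i ≠ j → ∀ m n : ℤ, m ≠ 0 → m * α j ≠ n * α i) (v : ℝ) (i : ι) (n : ℤ)
    (hn : n ≠ 0) :
    Tendsto (fun z => (z - sinhPole (α i) n) * sinhKernel α v z) (𝓝[≠] (sinhPole (α i) n))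
      (𝓝 (sinhResidue α v i n)) := by
  set p := sinhPole (α i) n with hp
  have hα' : ∀ j, (α j : ℂ) ≠ 0 := fun j => by exact_mod_cast (hα j).ne'
  have hp0 : p ≠ 0 := by
    rw [hp, sinhPole]
    have : (n : ℂ) ≠ 0 := by exact_mod_cast hn
    simp [hα', this, Real.pi_ne_zero]
  have hz : 2 * Complex.sinh (α i * p / 2) = 0 :=
    (two_mul_sinh_eq_zero_iff (hα i) p).2 ⟨n, rfl⟩
  have hder : HasDerivAt (fun z : ℂ => 2 * Complex.sinh (α i * z / 2))
      (α i * Complex.cosh (α i * p / 2)) p := by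
    have h1 : HasDerivAt (fun z : ℂ => α i * z / 2) (α i / 2 : ℂ) p := by
      simpa using ((hasDerivAt_id p).const_mul (α i : ℂ)).div_const 2
    have h2 := (h1.csinh).const_mul 2
    exact h2.congr_deriv (by ring)
  have hslope : Tendsto (fun z => (2 * Complex.sinh (α i * z / 2)) / (z - p)) (𝓝[≠] p)
      (𝓝 (α i * Complex.cosh (α i * p / 2))) := by
    refine (hasDerivAt_iff_tendsto_slope.1 hder).congr (fun z => ?_)
    rw [slope_def_field, hz, sub_zero]
  have hcosh : Complex.cosh (α i * p / 2) ≠ 0 := fun h => by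
    have h1 := Complex.cosh_sq (α i * p / 2)
    have h2 : Complex.sinh (α i * p / 2) = 0 := by simpa using hz
    rw [h, h2] at h1
    norm_num at h1
  have hprod : ∏ j ∈ Finset.univ.erase i, (2 * Complex.sinh (α j * p / 2)) ≠ 0 := by
    rw [Finset.prod_ne_zero_iff]
    intro j hj h
    obtain ⟨m, hm⟩ := (two_mul_sinh_eq_zero_iff (hα j) p).1 h
    refine hirr i j (Finset.ne_of_mem_erase hj).symm n m hn ?_
    rw [hp, sinhPole, div_eq_div_iff (hα' i) (hα' j)] at hm
    have h2 : (2 * Real.pi * Complex.I : ℂ) ≠ 0 := Complex.two_pi_I_ne_zero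
    have h3 : (n * α j : ℂ) = m * α i := mul_left_cancel₀ h2 (by linear_combination hm)
    exact_mod_cast h3
  have hc : ∀ h : ℂ → ℂ, Continuous h → Tendsto h (𝓝[≠] p) (𝓝 (h p)) := fun h hh =>
    (hh.tendsto p).mono_left nhdsWithin_le_nhds
  have hlim := (hc (fun z => Complex.exp (v * z)) (by fun_prop)).div
    ((hc (fun z => z) continuous_id).mul (hslope.mul
      (hc (fun z => ∏ j ∈ Finset.univ.erase i, (2 * Complex.sinh (α j * z / 2)))
        (by fun_prop))))
    (mul_ne_zero hp0 (mul_ne_zero (mul_ne_zero (hα' i) hcosh) hprod))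
  refine hlim.congr' ?_
  filter_upwards [self_mem_nhdsWithin] with z hzp
  have hzp' : z - p ≠ 0 := sub_ne_zero.2 hzp
  simp only [Pi.div_apply, sinhKernel]
  rw [← Finset.mul_prod_erase Finset.univ _ (Finset.mem_univ i)]
  generalize 2 * Complex.sinh (α i * z / 2) = A
  generalize ∏ j ∈ Finset.univ.erase i, (2 * Complex.sinh (α j * z / 2)) = B
  rw [show z * (A / (z - p) * B) = (z * (A * B)) / (z - p) by ring, div_div_eq_mul_div]
  ring

theorem sinhPole_ne_zero {a : ℝ} (ha : 0 < a) {n : ℤ} (hn : n ≠ 0) : sinhPole a n ≠ 0 := by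
  have h1 : (a : ℂ) ≠ 0 := by exact_mod_cast ha.ne'
  have h2 : (n : ℂ) ≠ 0 := by exact_mod_cast hn
  simp [sinhPole, h1, h2, Real.pi_ne_zero]

theorem norm_sinhPole {a : ℝ} (ha : 0 < a) (n : ℤ) :
    ‖sinhPole a n‖ = 2 * Real.pi * |(n : ℝ)| / a := by
  simp [sinhPole, abs_of_pos ha, abs_of_pos Real.pi_pos]

theorem sinhPole_injective {ι : Type*} (α : ι → ℝ) (hα : ∀ i, 0 < α i)
    (hirr : ∀ i j, i ≠ j → ∀ m n : ℤ, m ≠ 0 → m * α j ≠ n * α i) {i j : ι} {m n : ℤ}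
    (hm : m ≠ 0) (h : sinhPole (α i) m = sinhPole (α j) n) : i = j ∧ m = n := by
  have hα' : ∀ j, (α j : ℂ) ≠ 0 := fun j => by exact_mod_cast (hα j).ne'
  rw [sinhPole, sinhPole, div_eq_div_iff (hα' i) (hα' j)] at h
  have h3 : (m * α j : ℂ) = n * α i :=
    mul_left_cancel₀ Complex.two_pi_I_ne_zero (by linear_combination h)
  have h4 : m * α j = n * α i := by exact_mod_cast h3
  by_cases hij : i = j
  · subst hij
    exact ⟨rfl, by exact_mod_cast mul_right_cancel₀ (hα i).ne' h4⟩
  · exact absurd h4 (hirr i j hij m n hm)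

theorem differentiableAt_sinhKernel {ι : Type*} [Fintype ι] (α : ι → ℝ) (v : ℝ) (z : ℂ)
    (hz : z ≠ 0) (h : ∀ i, 2 * Complex.sinh (α i * z / 2) ≠ 0) :
    DifferentiableAt ℂ (sinhKernel α v) z := by
  refine DifferentiableAt.div (by fun_prop) (by fun_prop) ?_
  exact mul_ne_zero hz (Finset.prod_ne_zero_iff.2 fun i _ => h i)

/-! ### Circle integrals of the kernel and their decay -/

/-- The integral of `sinhKernel α v` over a circle that avoids the poles. -/
theorem circleIntegral_sinhKernel {ι : Type*} [Fintype ι] [DecidableEq ι] (α : ι → ℝ)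
    (hα : ∀ i, 0 < α i)
    (hirr : ∀ i j, i ≠ j → ∀ m n : ℤ, m ≠ 0 → m * α j ≠ n * α i) (v : ℝ)
    (a₀ a₁ a₂ a₃ : ℂ)
    (h0 : Tendsto (fun z => (z ^ 4 * sinhKernel α v z -
      (a₀ + a₁ * z + a₂ * z ^ 2 + a₃ * z ^ 3)) / z ^ 3) (𝓝[≠] 0) (𝓝 0))
    {R : ℝ} (hR : 0 < R) (hsin : ∀ i, Real.sin (Real.pi * α i * R) ≠ 0) :
    (∮ z in C(0, 2 * Real.pi * R), sinhKernel α v z) = 2 * Real.pi * Complex.I *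
      (a₃ + ∑ i, ∑ k ∈ Finset.Icc 1 ⌊R * α i⌋₊,
        (sinhResidue α v i k + sinhResidue α v i (-k))) := by
  -- A pair (k, sign) with k ≥ 1 encodes the nonzero index ±k, so that conjugate poles end up in the
  -- same summand.
  set sgn : ℕ × Bool → ℤ := fun k => if k.2 then k.1 else -k.1 with hsgn
  set s : Finset (Σ _ : ι, ℕ × Bool) :=
    Finset.univ.sigma fun i => Finset.Icc 1 ⌊R * α i⌋₊ ×ˢ Finset.univ with hs
  have hmem : ∀ x : Σ _ : ι, ℕ × Bool, x ∈ s ↔ 1 ≤ x.2.1 ∧ x.2.1 ≤ ⌊R * α x.1⌋₊ := fun x => by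
    simp [hs]
  have hne : ∀ x ∈ s, sgn x.2 ≠ 0 := fun x hx => by
    have := ((hmem x).1 hx).1
    simp only [hsgn]
    split_ifs <;> omega
  have habs : ∀ k, |(sgn k : ℝ)| = k.1 := fun k => by
    simp only [hsgn]
    split_ifs <;> simp
  have hRα : ∀ i, 0 < R * α i := fun i => mul_pos hR (hα i)
  have key := circleIntegral_eq_sum_residues (T := 2 * Real.pi * R) (by positivity) s
    (fun x => sinhPole (α x.1) (sgn x.2)) (fun x => sinhResidue α v x.1 (sgn x.2))
    (sinhKernel α v) a₀ a₁ a₂ a₃ ?_ ?_ ?_ ?_ ?_ h0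
  · rw [key, hs, Finset.sum_sigma]
    congr 2
    refine Finset.sum_congr rfl fun i _ => ?_
    rw [Finset.sum_product]
    refine Finset.sum_congr rfl fun k _ => ?_
    simp [hsgn]
  · rintro ⟨i, k, b⟩ hx ⟨j, l, b'⟩ hy h
    obtain ⟨rfl, h2⟩ := sinhPole_injective α hα hirr (hne _ hx) h
    have h3 := (hmem _).1 hx
    have h4 := (hmem _).1 hy
    simp only [hsgn] at h2 h3 h4
    obtain ⟨rfl, rfl⟩ : k = l ∧ b = b' := by
      cases b <;> cases b' <;> simp at h2 ⊢ <;> omega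
    rfl
  · exact fun x hx => sinhPole_ne_zero (hα _) (hne x hx)
  · intro x hx
    obtain ⟨h1, h2⟩ := (hmem x).1 hx
    rw [norm_sinhPole (hα _), habs, div_lt_iff₀ (hα _), mul_assoc (2 * Real.pi) R]
    refine mul_lt_mul_of_pos_left ?_ (by positivity)
    -- Equality k = R αᵢ would put the pole on the circle, and then sin(π αᵢ R) = 0.
    refine lt_of_le_of_ne ((Nat.le_floor_iff (hRα _).le).1 h2) fun h => hsin x.1 ?_
    rw [show Real.pi * α x.1 * R = (x.2.1 : ℕ) * Real.pi by rw [h]; ring]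
    exact Real.sin_nat_mul_pi _
  · intro z hz hz0 hzp
    refine differentiableAt_sinhKernel α v z hz0 fun i h => ?_
    obtain ⟨n, hn⟩ := (two_mul_sinh_eq_zero_iff (hα i) z).1 h
    have hn0 : n ≠ 0 := by
      rintro rfl
      exact hz0 (by simpa using hn)
    have hle : (n.natAbs : ℝ) ≤ R * α i := by
      have h1 : ‖z‖ ≤ 2 * Real.pi * R := by simpa using hz
      rw [hn, ← sinhPole, norm_sinhPole (hα _), div_le_iff₀ (hα _), mul_assoc (2 * Real.pi) R] at h1
      rw [Nat.cast_natAbs, Int.cast_abs]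
      exact le_of_mul_le_mul_left h1 (by positivity)
    refine hzp ⟨i, n.natAbs, decide (0 < n)⟩ ((hmem _).2 ⟨?_, Nat.le_floor hle⟩) ?_
    · exact Nat.one_le_iff_ne_zero.2 (Int.natAbs_ne_zero.2 hn0)
    · rw [hn, ← sinhPole]
      congr 1
      simp only [hsgn, decide_eq_true_eq]
      split_ifs <;> omega
  · exact fun x hx => tendsto_sub_mul_sinhKernel α hα hirr v x.1 _ (hne x hx)

/-- The integrals of `sinhKernel α v` over circles whose radii stay away from the poles tend to
zero. -/
theorem tendsto_circleIntegral_sinhKernel {ι : Type*} [Fintype ι] (α : ι → ℝ)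
    (hα : ∀ i, 0 < α i) {v : ℝ} (hv : |v| < ∑ i, α i / 2) {R : ℕ → ℝ}
    (hR : Tendsto R atTop atTop) {κ : ℝ} (hκ : 0 < κ)
    (hsin : ∀ j i, κ ≤ |Real.sin (Real.pi * α i * R j)|) :
    Tendsto (fun j => ∮ z in C(0, 2 * Real.pi * R j), sinhKernel α v z) atTop (𝓝 0) := by
  choose m hm hbound using fun i => exists_mul_exp_le_norm_two_mul_sinh (hα i) hκ
  set δ : ℝ := ∑ i, α i / 2 - |v| with hδ
  have hδ0 : 0 < δ := sub_pos.2 hv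
  set M : ℝ := ∏ i, m i with hM
  have hM0 : 0 < M := Finset.prod_pos fun i _ => hm i
  have hT : Tendsto (fun j => 2 * Real.pi * R j) atTop atTop :=
    hR.const_mul_atTop (by positivity)
  have hlarge : ∀ᶠ j in atTop, 1 ≤ 2 * Real.pi * R j ∧ ∀ i, α i / κ ≤ 2 * Real.pi * R j :=
    (hT.eventually_ge_atTop 1).and (eventually_all.2 fun i => hT.eventually_ge_atTop _)
  -- Multiplying the sinh bounds beats |e^{vz}| by exp(δ|Re z|), where δ is the gap in the
  -- hypothesis on v. The extra factor z on the left comes from dz = iz dθ.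
  have hker : ∀ᶠ j in atTop, ∀ z : ℂ, ‖z‖ = 2 * Real.pi * R j →
      ‖z * sinhKernel α v z‖ ≤ M⁻¹ * Real.exp (-δ * |z.re|) := by
    filter_upwards [hlarge] with j hj z hz
    have hz0 : z ≠ 0 := by
      rintro rfl
      rw [norm_zero] at hz
      linarith [hj.1]
    have h1 : z * sinhKernel α v z =
        Complex.exp (v * z) / ∏ i, (2 * Complex.sinh (α i * z / 2)) := by
      rw [sinhKernel]; field_simp
    have h2 : M * Real.exp ((∑ i, α i / 2) * |z.re|) ≤
        ‖∏ i, (2 * Complex.sinh (α i * z / 2))‖ := by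
      rw [norm_prod, hM, Finset.sum_mul, Real.exp_sum, ← Finset.prod_mul_distrib]
      refine Finset.prod_le_prod (fun i _ => by have := hm i; positivity) fun i _ => ?_
      have := hbound i _ hj.1 (hj.2 i) (by
        rw [show α i * (2 * Real.pi * R j) / 2 = Real.pi * α i * R j by ring]
        exact hsin j i) z hz
      rwa [show α i / 2 * |z.re| = α i * |z.re| / 2 by ring]
    have h3 : ‖Complex.exp (v * z)‖ ≤ Real.exp (|v| * |z.re|) := by
      rw [Complex.norm_exp, Complex.re_ofReal_mul, ← abs_mul]
      exact Real.exp_le_exp.2 (le_abs_self _)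
    rw [h1, norm_div]
    refine (div_le_div₀ (Real.exp_nonneg _) h3 (by positivity) h2).trans (le_of_eq ?_)
    rw [div_eq_inv_mul, mul_inv, mul_assoc, ← Real.exp_neg, ← Real.exp_add]
    congr 2
    rw [hδ]; ring
  have hcongr : ∀ j, (∮ z in C(0, 2 * Real.pi * R j), sinhKernel α v z) =
      ∫ θ in (0 : ℝ)..2 * Real.pi, Complex.I * (circleMap 0 (2 * Real.pi * R j) θ *
        sinhKernel α v (circleMap 0 (2 * Real.pi * R j) θ)) := fun j => by
    rw [circleIntegral]
    refine intervalIntegral.integral_congr fun θ _ => ?_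
    simp only [deriv_circleMap, smul_eq_mul]
    ring
  simp only [hcongr]
  have hre : ∀ T θ, (circleMap 0 T θ).re = T * Real.cos θ := fun T θ => by
    simp [circleMap, Complex.exp_re]
  have hnorm : ∀ᶠ j in atTop, ∀ θ,
      ‖circleMap 0 (2 * Real.pi * R j) θ‖ = 2 * Real.pi * R j := by
    filter_upwards [hlarge] with j hj θ
    simp only [norm_circleMap_zero]
    exact abs_of_pos (by linarith [hj.1])
  -- The bound exp(-δ T |cos θ|) decays except where the circle meets the imaginary axis, a null set
  -- of angles; dominated convergence does the rest.
  have hcos : ∀ᵐ θ : ℝ, Real.cos θ ≠ 0 := by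
    have : {θ : ℝ | Real.cos θ = 0}.Countable := by
      have h : {θ : ℝ | Real.cos θ = 0} ⊆
          Set.range fun k : ℤ => (2 * (k : ℝ) + 1) * Real.pi / 2 := fun θ hθ => by
        obtain ⟨k, hk⟩ := Real.cos_eq_zero_iff.1 hθ
        exact ⟨k, hk.symm⟩
      exact (Set.countable_range _).mono h
    filter_upwards [this.ae_notMem MeasureTheory.volume] with θ hθ using hθ
  have hmeas : Measurable (sinhKernel α v) := by
    unfold sinhKernel
    fun_prop
  have main := intervalIntegral.tendsto_integral_filter_of_dominated_convergence
    (μ := MeasureTheory.volume) (a := 0) (b := 2 * Real.pi) (l := atTop)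
    (F := fun j θ => Complex.I * (circleMap 0 (2 * Real.pi * R j) θ *
        sinhKernel α v (circleMap 0 (2 * Real.pi * R j) θ))) (f := fun _ => 0)
    (fun _ => M⁻¹) (Eventually.of_forall fun j => ?_) ?_ (by simp) ?_
  · simpa using main
  · have hcm : Measurable (circleMap 0 (2 * Real.pi * R j)) := (continuous_circleMap _ _).measurable
    exact (measurable_const.mul (hcm.mul (hmeas.comp hcm))).aestronglyMeasurable
  · filter_upwards [hker, hnorm] with j hj hj'
    refine Eventually.of_forall fun θ _ => ?_
    rw [norm_mul, Complex.norm_I, one_mul]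
    refine (hj _ (hj' θ)).trans (mul_le_of_le_one_right (by positivity) ?_)
    rw [Real.exp_le_one_iff, neg_mul, neg_nonpos]
    positivity
  · filter_upwards [hcos] with θ hθ _
    refine squeeze_zero_norm' (a := fun j => M⁻¹ *
      Real.exp (-(δ * |Real.cos θ| * (2 * Real.pi * R j)))) ?_ ?_
    · filter_upwards [hker, hnorm, hlarge] with j hj hj' hl
      rw [norm_mul, Complex.norm_I, one_mul]
      refine (hj _ (hj' θ)).trans (le_of_eq ?_)
      rw [hre, abs_mul, abs_of_pos (by linarith [hl.1] : 0 < 2 * Real.pi * R j)]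
      congr 2
      ring
    · have h1 : Tendsto (fun j => δ * |Real.cos θ| * (2 * Real.pi * R j)) atTop atTop :=
        hT.const_mul_atTop (mul_pos hδ0 (abs_pos.2 hθ))
      simpa using (Real.tendsto_exp_neg_atTop_nhds_zero.comp h1).const_mul M⁻¹

/-- The sum of the residues of `sinhKernel α v` in growing discs tends to zero. -/
theorem tendsto_sum_sinhResidue {ι : Type*} [Fintype ι] [DecidableEq ι] (α : ι → ℝ)
    (hα : ∀ i, 0 < α i)
    (hirr : ∀ i j, i ≠ j → ∀ m n : ℤ, m ≠ 0 → m * α j ≠ n * α i) {v : ℝ}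
    (hv : |v| < ∑ i, α i / 2) {R : ℕ → ℝ}
    (hR : Tendsto R atTop atTop) {κ : ℝ} (hκ : 0 < κ)
    (hsin : ∀ j i, κ ≤ |Real.sin (Real.pi * α i * R j)|) (a₀ a₁ a₂ a₃ : ℂ)
    (h0 : Tendsto (fun z => (z ^ 4 * sinhKernel α v z -
      (a₀ + a₁ * z + a₂ * z ^ 2 + a₃ * z ^ 3)) / z ^ 3) (𝓝[≠] 0) (𝓝 0)) :
    Tendsto (fun j => a₃ + ∑ i, ∑ k ∈ Finset.Icc 1 ⌊R j * α i⌋₊,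
      (sinhResidue α v i k + sinhResidue α v i (-k))) atTop (𝓝 0) := by
  have h := (tendsto_circleIntegral_sinhKernel α hα hv hR hκ hsin).const_mul
    (2 * Real.pi * Complex.I : ℂ)⁻¹
  rw [mul_zero] at h
  refine h.congr' ?_
  filter_upwards [hR.eventually_gt_atTop 0] with j hj
  rw [circleIntegral_sinhKernel α hα hirr v a₀ a₁ a₂ a₃ h0 hj fun i hi => ?_,
    inv_mul_cancel_left₀ Complex.two_pi_I_ne_zero]
  have := hsin j i
  rw [hi, abs_zero] at this
  linarith

/-! ### Expansions at 0, for the residue at the origin -/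

/-- `f` has the third order expansion `a₀ + a₁ z + a₂ z² + a₃ z³ + o(z³)` at `0`. -/
def HasCubicExpansion (f : ℂ → ℂ) (a₀ a₁ a₂ a₃ : ℂ) : Prop :=
  Tendsto (fun z => (f z - (a₀ + a₁ * z + a₂ * z ^ 2 + a₃ * z ^ 3)) / z ^ 3) (𝓝[≠] 0) (𝓝 0)

namespace HasCubicExpansion

variable {f g : ℂ → ℂ} {a₀ a₁ a₂ a₃ b₀ b₁ b₂ b₃ : ℂ}

theorem congr_of_ne_zero (hf : HasCubicExpansion f a₀ a₁ a₂ a₃) (h : ∀ z, z ≠ 0 → f z = g z) :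
    HasCubicExpansion g a₀ a₁ a₂ a₃ := by
  refine Tendsto.congr' ?_ hf
  filter_upwards [self_mem_nhdsWithin] with z hz
  rw [h z hz]

theorem poly (a₀ a₁ a₂ a₃ : ℂ) :
    HasCubicExpansion (fun z => a₀ + a₁ * z + a₂ * z ^ 2 + a₃ * z ^ 3) a₀ a₁ a₂ a₃ := by
  simp [HasCubicExpansion]

theorem tendsto_of_continuous {f : ℂ → ℂ} (hf : Continuous f) : Tendsto f (𝓝[≠] 0) (𝓝 (f 0)) :=
  (hf.tendsto 0).mono_left nhdsWithin_le_nhds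

theorem mul (hf : HasCubicExpansion f a₀ a₁ a₂ a₃) (hg : HasCubicExpansion g b₀ b₁ b₂ b₃) :
    HasCubicExpansion (fun z => f z * g z) (a₀ * b₀) (a₀ * b₁ + a₁ * b₀)
      (a₀ * b₂ + a₁ * b₁ + a₂ * b₀) (a₀ * b₃ + a₁ * b₂ + a₂ * b₁ + a₃ * b₀) := by
  have h1 := Tendsto.mul hf (tendsto_of_continuous
    (f := fun z => b₀ + b₁ * z + b₂ * z ^ 2 + b₃ * z ^ 3) (by fun_prop))
  have h2 := (tendsto_of_continuous
    (f := fun z => a₀ + a₁ * z + a₂ * z ^ 2 + a₃ * z ^ 3) (by fun_prop)).mul hg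
  have h3 := (tendsto_of_continuous (f := fun z => z ^ 3) (by fun_prop)).mul (Tendsto.mul hf hg)
  have h4 := tendsto_of_continuous (f := fun z => z * (a₁ * b₃ + a₂ * b₂ + a₃ * b₁ +
    (a₂ * b₃ + a₃ * b₂) * z + a₃ * b₃ * z ^ 2)) (by fun_prop)
  have h := ((h1.add h2).add h3).add h4
  simp only [zero_mul, mul_zero, add_zero] at h
  refine Tendsto.congr' ?_ h
  filter_upwards [self_mem_nhdsWithin] with z hz
  have hz' : z ≠ 0 := hz
  field_simp
  ring

theorem tendsto (hf : HasCubicExpansion f a₀ a₁ a₂ a₃) : Tendsto f (𝓝[≠] 0) (𝓝 a₀) := by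
  have h1 := (tendsto_of_continuous (f := fun z => z ^ 3) (by fun_prop)).mul hf
  have h2 := tendsto_of_continuous
    (f := fun z => a₀ + a₁ * z + a₂ * z ^ 2 + a₃ * z ^ 3) (by fun_prop)
  have h := h1.add h2
  simp only [mul_zero, zero_add, add_zero, ne_eq, OfNat.ofNat_ne_zero, not_false_eq_true,
    zero_pow] at h
  refine Tendsto.congr' ?_ h
  filter_upwards [self_mem_nhdsWithin] with z hz
  have hz' : z ≠ 0 := hz
  field_simp
  ring

/-- The four equations say that the product of the two polynomials is 1 up to o(z³); dividing the
error of f · P = 1 + o(z³) by f, whose limit is nonzero, gives the claim. -/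
theorem inv (hf : HasCubicExpansion f a₀ a₁ a₂ a₃) (h0 : a₀ * b₀ = 1)
    (h1 : a₀ * b₁ + a₁ * b₀ = 0) (h2 : a₀ * b₂ + a₁ * b₁ + a₂ * b₀ = 0)
    (h3 : a₀ * b₃ + a₁ * b₂ + a₂ * b₁ + a₃ * b₀ = 0) :
    HasCubicExpansion (fun z => (f z)⁻¹) b₀ b₁ b₂ b₃ := by
  have ha : a₀ ≠ 0 := by
    rintro rfl
    simp at h0
  have hm := hf.mul (poly b₀ b₁ b₂ b₃)
  rw [h0, h1, h2, h3] at hm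
  have h := (Tendsto.mul hm (hf.tendsto.inv₀ ha)).neg
  rw [zero_mul, neg_zero] at h
  refine Tendsto.congr' ?_ h
  filter_upwards [self_mem_nhdsWithin, hf.tendsto.eventually_ne ha] with z hz hfz
  have hz' : z ≠ 0 := hz
  field_simp
  ring

end HasCubicExpansion

theorem tendsto_exp_sub_sum_div_pow (c : ℂ) (n : ℕ) :
    Tendsto (fun z => (Complex.exp (c * z) - ∑ i ∈ Finset.range (n + 1), (c * z) ^ i / i.factorial)
      / z ^ n) (𝓝[≠] 0) (𝓝 0) := by
  have h1 := (Complex.exp_sub_sum_range_succ_isLittleO_pow n).comp_tendsto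
    (show Tendsto (fun z : ℂ => c * z) (𝓝[≠] 0) (𝓝 0) by
      have := HasCubicExpansion.tendsto_of_continuous (f := fun z => c * z) (by fun_prop)
      simpa using this)
  have h2 : ((fun x : ℂ => x ^ n) ∘ fun z : ℂ => c * z) =O[𝓝[≠] 0] fun z : ℂ => z ^ n := by
    have : ((fun x : ℂ => x ^ n) ∘ fun z : ℂ => c * z) = fun z => c ^ n * z ^ n := by
      ext z; simp [mul_pow]
    rw [this]
    exact Asymptotics.isBigO_const_mul_self _ _ _
  have h := (h1.trans_isBigO h2).tendsto_div_nhds_zero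
  exact h

theorem hasCubicExpansion_exp (c : ℂ) :
    HasCubicExpansion (fun z => Complex.exp (c * z)) 1 c (c ^ 2 / 2) (c ^ 3 / 6) := by
  refine (tendsto_exp_sub_sum_div_pow c 3).congr fun z => ?_
  simp only [Finset.sum_range_succ, Finset.sum_range_zero, Nat.factorial]
  norm_num
  ring

theorem hasCubicExpansion_div_two_mul_sinh {a : ℝ} (ha : 0 < a) :
    HasCubicExpansion (fun z => z / (2 * Complex.sinh (a * z / 2))) (1 / a) 0 (-a / 24) 0 := by
  have ha' : (a : ℂ) ≠ 0 := by exact_mod_cast ha.ne'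
  have h1 : HasCubicExpansion (fun z => 2 * Complex.sinh (a * z / 2) / z) a 0 (a ^ 3 / 24) 0 := by
    -- Order four is needed because the quotient by z loses one order.
    have h := (tendsto_exp_sub_sum_div_pow (a / 2) 4).sub
      (tendsto_exp_sub_sum_div_pow (-(a / 2)) 4)
    rw [sub_zero] at h
    refine Tendsto.congr' ?_ h
    filter_upwards [self_mem_nhdsWithin] with z hz
    have hz' : z ≠ 0 := hz
    rw [Complex.two_sinh, show (a * z / 2 : ℂ) = a / 2 * z by ring, ← neg_mul]
    simp only [Finset.sum_range_succ, Finset.sum_range_zero, Nat.factorial]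
    generalize Complex.exp (a / 2 * z) = A
    generalize Complex.exp (-(a / 2) * z) = B
    norm_num
    field_simp
    ring
  have h2 := h1.inv (b₀ := 1 / a) (b₁ := 0) (b₂ := -a / 24) (b₃ := 0) (by field_simp) (by ring)
    (by field_simp; ring) (by ring)
  exact h2.congr_of_ne_zero fun z _ => by rw [inv_div]

/-! ### Conjugate residues in real form -/

theorem exp_mul_sinhPole (a v : ℝ) (n : ℤ) :
    Complex.exp (v * sinhPole a n) = (Real.cos (2 * Real.pi * n * (v / a)) : ℂ) +
      (Real.sin (2 * Real.pi * n * (v / a)) : ℂ) * Complex.I := by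
  rw [sinhPole, show (v * (2 * Real.pi * n * Complex.I / a) : ℂ) =
    ((2 * Real.pi * n * (v / a) : ℝ) : ℂ) * Complex.I by push_cast; ring, Complex.exp_mul_I]
  push_cast
  rfl

theorem two_mul_sinh_sinhPole (a b : ℝ) (n : ℤ) :
    2 * Complex.sinh (b * sinhPole a n / 2) =
      2 * (Real.sin (Real.pi * n * b / a) : ℂ) * Complex.I := by
  rw [sinhPole, show (b * (2 * Real.pi * n * Complex.I / a) / 2 : ℂ) =
    ((Real.pi * n * b / a : ℝ) : ℂ) * Complex.I by push_cast; ring, Complex.sinh_mul_I]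
  push_cast
  ring

theorem sinhPole_mul_cosh {a : ℝ} (ha : 0 < a) (n : ℤ) :
    sinhPole a n * (a * Complex.cosh (a * sinhPole a n / 2)) =
      2 * Real.pi * n * (Real.cos (n * Real.pi) : ℂ) * Complex.I := by
  have ha' : (a : ℂ) ≠ 0 := by exact_mod_cast ha.ne'
  rw [sinhPole, show (a * (2 * Real.pi * n * Complex.I / a) / 2 : ℂ) =
    ((n * Real.pi : ℝ) : ℂ) * Complex.I by push_cast; field_simp, Complex.cosh_mul_I]
  push_cast
  field_simp

/-- The sum of the residues at `± 2πik/a` of the kernel with one factor. -/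
def residuePairOne (a v : ℝ) (k : ℕ) : ℝ :=
  (-1) ^ k * Real.sin (2 * Real.pi * k * (v / a)) / (Real.pi * k)

/-- The sum of the residues at `± 2πik/a` of the kernel with two factors. -/
def residuePairTwo (a b v : ℝ) (k : ℕ) : ℝ :=
  -((-1) ^ k * Real.cos (2 * Real.pi * k * (v / a))) /
    (2 * Real.pi * k * Real.sin (Real.pi * k * b / a))

/-- The sum of the residues at `± 2πik/a` of the kernel with three factors. -/
def residuePairThree (a b c v : ℝ) (k : ℕ) : ℝ :=
  -((-1) ^ k * Real.sin (2 * Real.pi * k * (v / a))) /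
    (4 * Real.pi * k * Real.sin (Real.pi * k * b / a) * Real.sin (Real.pi * k * c / a))

theorem sinhResidue_eq {ι : Type*} [Fintype ι] [DecidableEq ι] (α : ι → ℝ) (hα : ∀ i, 0 < α i)
    (v : ℝ) (i : ι) (n : ℤ) :
    sinhResidue α v i n = ((Real.cos (2 * Real.pi * n * (v / α i)) : ℂ) +
      (Real.sin (2 * Real.pi * n * (v / α i)) : ℂ) * Complex.I) /
      (2 * Real.pi * n * (Real.cos (n * Real.pi) : ℂ) * Complex.I *
        ∏ j ∈ Finset.univ.erase i,
          (2 * (Real.sin (Real.pi * n * α j / α i) : ℂ) * Complex.I)) := by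
  rw [sinhResidue, ← mul_assoc, sinhPole_mul_cosh (hα i), exp_mul_sinhPole]
  simp only [two_mul_sinh_sinhPole]

theorem cos_nat_mul_pi_complex (k : ℕ) : ((Real.cos (k * Real.pi) : ℝ) : ℂ) = (-1) ^ k := by
  rw [Real.cos_nat_mul_pi]; push_cast; rfl

theorem sinhResidue_add_neg_one (α : Fin 1 → ℝ) (hα : ∀ i, 0 < α i) (v : ℝ) (i : Fin 1) {k : ℕ}
    (hk : k ≠ 0) :
    sinhResidue α v i k + sinhResidue α v i (-k) = residuePairOne (α i) v k := by
  have hp : (Real.pi : ℂ) ≠ 0 := by exact_mod_cast Real.pi_ne_zero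
  have hk' : (k : ℂ) ≠ 0 := by exact_mod_cast hk
  have he : (Finset.univ.erase i : Finset (Fin 1)) = ∅ := by fin_cases i; rfl
  rw [sinhResidue_eq α hα, sinhResidue_eq α hα, he]
  simp only [Finset.prod_empty, Int.cast_neg, Int.cast_natCast, mul_neg, neg_mul, Real.cos_neg,
    Real.sin_neg, residuePairOne, Complex.ofReal_neg, cos_nat_mul_pi_complex]
  push_cast
  rcases neg_one_pow_eq_or ℂ k with h | h <;> rw [h] <;> field_simp <;> ring

theorem sinhResidue_add_neg_two (α : Fin 2 → ℝ) (hα : ∀ i, 0 < α i) (v : ℝ) (i j : Fin 2)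
    (he : (Finset.univ.erase i : Finset (Fin 2)) = {j}) {k : ℕ} (hk : k ≠ 0)
    (hs : Real.sin (Real.pi * k * α j / α i) ≠ 0) :
    sinhResidue α v i k + sinhResidue α v i (-k) = residuePairTwo (α i) (α j) v k := by
  have hp : (Real.pi : ℂ) ≠ 0 := by exact_mod_cast Real.pi_ne_zero
  have hk' : (k : ℂ) ≠ 0 := by exact_mod_cast hk
  have hs' : ((Real.sin (Real.pi * k * α j / α i) : ℝ) : ℂ) ≠ 0 := by exact_mod_cast hs
  rw [sinhResidue_eq α hα, sinhResidue_eq α hα, he]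
  simp only [Finset.prod_singleton, Int.cast_neg, Int.cast_natCast, mul_neg, neg_mul, neg_div,
    Real.cos_neg, Real.sin_neg, residuePairTwo, Complex.ofReal_neg, cos_nat_mul_pi_complex,
    Complex.ofReal_mul, Complex.ofReal_div, Complex.ofReal_pow, Complex.ofReal_one,
    Complex.ofReal_ofNat, Complex.ofReal_natCast]
  generalize ((Real.sin (Real.pi * k * α j / α i) : ℝ) : ℂ) = S at *
  generalize ((Real.sin (2 * Real.pi * k * (v / α i)) : ℝ) : ℂ) = A at *
  generalize ((Real.cos (2 * Real.pi * k * (v / α i)) : ℝ) : ℂ) = B at *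
  rcases neg_one_pow_eq_or ℂ k with h | h <;> rw [h] <;> field_simp <;> simp only [Complex.I_sq] <;>
    ring

theorem sinhResidue_add_neg_three (α : Fin 3 → ℝ) (hα : ∀ i, 0 < α i) (v : ℝ) (i j l : Fin 3)
    (he : (Finset.univ.erase i : Finset (Fin 3)) = {j, l}) (hjl : j ≠ l) {k : ℕ} (hk : k ≠ 0)
    (hs : Real.sin (Real.pi * k * α j / α i) ≠ 0) (ht : Real.sin (Real.pi * k * α l / α i) ≠ 0) :
    sinhResidue α v i k + sinhResidue α v i (-k) =
      residuePairThree (α i) (α j) (α l) v k := by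
  have hp : (Real.pi : ℂ) ≠ 0 := by exact_mod_cast Real.pi_ne_zero
  have hk' : (k : ℂ) ≠ 0 := by exact_mod_cast hk
  have hs' : ((Real.sin (Real.pi * k * α j / α i) : ℝ) : ℂ) ≠ 0 := by exact_mod_cast hs
  have ht' : ((Real.sin (Real.pi * k * α l / α i) : ℝ) : ℂ) ≠ 0 := by exact_mod_cast ht
  rw [sinhResidue_eq α hα, sinhResidue_eq α hα, he]
  simp only [Finset.prod_pair hjl, Int.cast_neg, Int.cast_natCast, mul_neg, neg_mul, neg_div,
    Real.cos_neg, Real.sin_neg, residuePairThree, Complex.ofReal_neg, cos_nat_mul_pi_complex,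
    Complex.ofReal_mul, Complex.ofReal_div, Complex.ofReal_pow, Complex.ofReal_one,
    Complex.ofReal_ofNat, Complex.ofReal_natCast]
  generalize ((Real.sin (Real.pi * k * α j / α i) : ℝ) : ℂ) = S at *
  generalize ((Real.sin (Real.pi * k * α l / α i) : ℝ) : ℂ) = U at *
  generalize ((Real.sin (2 * Real.pi * k * (v / α i)) : ℝ) : ℂ) = A at *
  generalize ((Real.cos (2 * Real.pi * k * (v / α i)) : ℝ) : ℂ) = B at *
  have hI3 : Complex.I ^ 3 = -Complex.I := by rw [pow_succ, Complex.I_sq]; ring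
  rcases neg_one_pow_eq_or ℂ k with h | h <;> rw [h] <;> field_simp <;>
    simp only [hI3] <;> ring

/-! ### Truncated residue sums and their decay -/

/-- The reals `a` and `b` have an irrational ratio. -/
def Incommensurable (a b : ℝ) : Prop :=
  ∀ m n : ℤ, m ≠ 0 → m * b ≠ n * a

/-- The points `2π R j` keep a positive distance from the poles `2πin/a`. -/
def AvoidsPoles (R : ℕ → ℝ) (a : ℝ) : Prop :=
  ∃ κ : ℝ, 0 < κ ∧ ∀ j, κ ≤ |Real.sin (Real.pi * a * R j)|

theorem Incommensurable.sin_ne_zero {a b : ℝ} (ha : 0 < a) (h : Incommensurable a b) {k : ℕ}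
    (hk : k ≠ 0) : Real.sin (Real.pi * k * b / a) ≠ 0 := fun h0 => by
  obtain ⟨n, hn⟩ := Real.sin_eq_zero_iff.1 h0
  refine h k n (by exact_mod_cast hk) ?_
  rw [eq_div_iff ha.ne'] at hn
  refine mul_left_cancel₀ Real.pi_ne_zero ?_
  push_cast
  linarith

/-- The sum of the residues in `‖z‖ < 2πR` of the kernel with one factor. -/
def oneSum (a v R : ℝ) : ℝ :=
  v / a + ∑ k ∈ Finset.Icc 1 ⌊R * a⌋₊, residuePairOne a v k

/-- The sum of the residues in `‖z‖ < 2πR` of the kernel with two factors. -/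
def twoSum (a b v R : ℝ) : ℝ :=
  (v ^ 2 / 2 - (a ^ 2 + b ^ 2) / 24) / (a * b) +
    (∑ k ∈ Finset.Icc 1 ⌊R * a⌋₊, residuePairTwo a b v k +
      ∑ k ∈ Finset.Icc 1 ⌊R * b⌋₊, residuePairTwo b a v k)

/-- The sum of the residues in `‖z‖ < 2πR` of the kernel with three factors. -/
def threeSum (a b c v R : ℝ) : ℝ :=
  (v ^ 3 / 6 - v * (a ^ 2 + b ^ 2 + c ^ 2) / 24) / (a * b * c) +
    (∑ k ∈ Finset.Icc 1 ⌊R * a⌋₊, residuePairThree a b c v k +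
      ∑ k ∈ Finset.Icc 1 ⌊R * b⌋₊, residuePairThree b a c v k +
      ∑ k ∈ Finset.Icc 1 ⌊R * c⌋₊, residuePairThree c a b v k)

theorem tendsto_complex_ofReal_iff {f : ℕ → ℝ} {x : ℝ} :
    Tendsto (fun j => (f j : ℂ)) atTop (𝓝 (x : ℂ)) ↔ Tendsto f atTop (𝓝 x) :=
  Complex.isUniformEmbedding_ofReal.isEmbedding.tendsto_nhds_iff.symm

theorem tendsto_oneSum_zero {a v : ℝ} (ha : 0 < a) (hv : |v| < a / 2) {R : ℕ → ℝ}
    (hR : Tendsto R atTop atTop) (hRa : AvoidsPoles R a) :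
    Tendsto (fun j => oneSum a v (R j)) atTop (𝓝 0) := by
  obtain ⟨κ, hκ, hsin⟩ := hRa
  have hα : ∀ i, 0 < ![a] i := by simpa using ha
  -- With n sinh factors the pole at 0 has order n + 1, so z⁴ times the kernel is z^{3-n} e^{vz} ∏
  -- z/(2sinh). The polynomial supplies this missing power: z² here, z for two factors, nothing for
  -- three.
  have h0 := ((((HasCubicExpansion.poly 0 0 1 0).mul (hasCubicExpansion_exp v)).mul
    (hasCubicExpansion_div_two_mul_sinh ha))).congr_of_ne_zero (g := fun z => z ^ 4 * sinhKernel ![a] v z)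
    fun z hz => by
      simp only [sinhKernel, Finset.univ_unique, Finset.prod_singleton, Fin.default_eq_zero,
        Matrix.cons_val_zero]
      generalize 2 * Complex.sinh (a * z / 2) = A
      field_simp
      ring
  have h := tendsto_sum_sinhResidue ![a] hα
    (by intro i j hij; exact absurd (Subsingleton.elim i j) hij)
    (v := v) (by simpa using hv) hR hκ (fun j i => by fin_cases i; exact hsin j) _ _ _ _ h0
  rw [← tendsto_complex_ofReal_iff, Complex.ofReal_zero]
  refine h.congr fun j => ?_
  rw [oneSum, Finset.univ_unique, Finset.sum_singleton, Complex.ofReal_add, Complex.ofReal_sum]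
  congr 1
  · push_cast; ring
  · exact Finset.sum_congr rfl fun k hk =>
      sinhResidue_add_neg_one _ hα _ _ (by have := (Finset.mem_Icc.1 hk).1; omega)

theorem tendsto_twoSum_zero {a b v : ℝ} (ha : 0 < a) (hb : 0 < b) (hab : Incommensurable a b)
    (hba : Incommensurable b a) (hv : |v| < (a + b) / 2) {R : ℕ → ℝ}
    (hR : Tendsto R atTop atTop) (hRa : AvoidsPoles R a) (hRb : AvoidsPoles R b) :
    Tendsto (fun j => twoSum a b v (R j)) atTop (𝓝 0) := by
  obtain ⟨κ, hκ, hsin⟩ := hRa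
  obtain ⟨κ', hκ', hsin'⟩ := hRb
  have hα : ∀ i, 0 < ![a, b] i := by simpa [Fin.forall_fin_two] using ⟨ha, hb⟩
  have h0 := (((((HasCubicExpansion.poly 0 1 0 0).mul (hasCubicExpansion_exp v)).mul
    (hasCubicExpansion_div_two_mul_sinh ha)).mul (hasCubicExpansion_div_two_mul_sinh hb))).congr_of_ne_zero
    (g := fun z => z ^ 4 * sinhKernel ![a, b] v z)
    fun z hz => by
      simp only [sinhKernel, Fin.prod_univ_two, Matrix.cons_val_zero, Matrix.cons_val_one]
      generalize 2 * Complex.sinh (a * z / 2) = A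
      generalize 2 * Complex.sinh (b * z / 2) = B
      field_simp
      ring
  have h := tendsto_sum_sinhResidue ![a, b] hα
    (by
      intro i j hij
      fin_cases i <;> fin_cases j
      exacts [absurd rfl hij, hab, hba, absurd rfl hij])
    (v := v) (by rw [Fin.sum_univ_two]; simpa [← add_div] using hv) hR (lt_min hκ hκ')
    (fun j i => by
      fin_cases i
      exacts [(min_le_left _ _).trans (hsin j), (min_le_right _ _).trans (hsin' j)]) _ _ _ _ h0
  rw [← tendsto_complex_ofReal_iff, Complex.ofReal_zero]
  refine h.congr fun j => ?_
  rw [twoSum, Fin.sum_univ_two, Complex.ofReal_add, Complex.ofReal_add, Complex.ofReal_sum,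
    Complex.ofReal_sum]
  have ha' : (a : ℂ) ≠ 0 := by exact_mod_cast ha.ne'
  have hb' : (b : ℂ) ≠ 0 := by exact_mod_cast hb.ne'
  congr 1
  · push_cast; field_simp; ring
  · congr 1
    · refine Finset.sum_congr rfl fun k hk => ?_
      have hk0 : k ≠ 0 := by have := (Finset.mem_Icc.1 hk).1; omega
      exact sinhResidue_add_neg_two ![a, b] hα v 0 1 (by decide) hk0 (hab.sin_ne_zero ha hk0)
    · refine Finset.sum_congr rfl fun k hk => ?_
      have hk0 : k ≠ 0 := by have := (Finset.mem_Icc.1 hk).1; omega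
      exact sinhResidue_add_neg_two ![a, b] hα v 1 0 (by decide) hk0 (hba.sin_ne_zero hb hk0)

theorem tendsto_threeSum_zero {a b c v : ℝ} (ha : 0 < a) (hb : 0 < b) (hc : 0 < c)
    (hab : Incommensurable a b) (hba : Incommensurable b a) (hac : Incommensurable a c)
    (hca : Incommensurable c a) (hbc : Incommensurable b c) (hcb : Incommensurable c b)
    (hv : |v| < (a + b + c) / 2) {R : ℕ → ℝ}
    (hR : Tendsto R atTop atTop) (hRa : AvoidsPoles R a) (hRb : AvoidsPoles R b)
    (hRc : AvoidsPoles R c) :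
    Tendsto (fun j => threeSum a b c v (R j)) atTop (𝓝 0) := by
  obtain ⟨κ, hκ, hsin⟩ := hRa
  obtain ⟨κ', hκ', hsin'⟩ := hRb
  obtain ⟨κ'', hκ'', hsin''⟩ := hRc
  have hα : ∀ i, 0 < ![a, b, c] i := fun i => by fin_cases i; exacts [ha, hb, hc]
  have h0 := ((((hasCubicExpansion_exp v).mul
    (hasCubicExpansion_div_two_mul_sinh ha)).mul (hasCubicExpansion_div_two_mul_sinh hb)).mul
      (hasCubicExpansion_div_two_mul_sinh hc)).congr_of_ne_zero
    (g := fun z => z ^ 4 * sinhKernel ![a, b, c] v z)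
    fun z hz => by
      simp only [sinhKernel, Fin.prod_univ_three, Matrix.cons_val_zero, Matrix.cons_val_one,
        Matrix.cons_val]
      generalize 2 * Complex.sinh (a * z / 2) = A
      generalize 2 * Complex.sinh (b * z / 2) = B
      generalize 2 * Complex.sinh (c * z / 2) = C
      field_simp
  have h := tendsto_sum_sinhResidue ![a, b, c] hα
    (by
      intro i j hij
      fin_cases i <;> fin_cases j
      exacts [absurd rfl hij, hab, hac, hba, absurd rfl hij, hbc, hca, hcb, absurd rfl hij])
    (v := v) (by rw [Fin.sum_univ_three]; simpa [← add_div] using hv) hR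
    (lt_min hκ (lt_min hκ' hκ''))
    (fun j i => by
      fin_cases i
      exacts [(min_le_left _ _).trans (hsin j),
        ((min_le_right _ _).trans (min_le_left _ _)).trans (hsin' j),
        ((min_le_right _ _).trans (min_le_right _ _)).trans (hsin'' j)]) _ _ _ _ h0
  rw [← tendsto_complex_ofReal_iff, Complex.ofReal_zero]
  refine h.congr fun j => ?_
  rw [threeSum, Fin.sum_univ_three, Complex.ofReal_add, Complex.ofReal_add, Complex.ofReal_add,
    Complex.ofReal_sum, Complex.ofReal_sum, Complex.ofReal_sum]
  have ha' : (a : ℂ) ≠ 0 := by exact_mod_cast ha.ne'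
  have hb' : (b : ℂ) ≠ 0 := by exact_mod_cast hb.ne'
  have hc' : (c : ℂ) ≠ 0 := by exact_mod_cast hc.ne'
  congr 1
  · push_cast; field_simp; ring
  · congr 1
    · congr 1
      · refine Finset.sum_congr rfl fun k hk => ?_
        have hk0 : k ≠ 0 := by have := (Finset.mem_Icc.1 hk).1; omega
        exact sinhResidue_add_neg_three ![a, b, c] hα v 0 1 2 (by decide) (by decide) hk0
          (hab.sin_ne_zero ha hk0) (hac.sin_ne_zero ha hk0)
      · refine Finset.sum_congr rfl fun k hk => ?_
        have hk0 : k ≠ 0 := by have := (Finset.mem_Icc.1 hk).1; omega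
        exact sinhResidue_add_neg_three ![a, b, c] hα v 1 0 2 (by decide) (by decide) hk0
          (hba.sin_ne_zero hb hk0) (hbc.sin_ne_zero hb hk0)
    · refine Finset.sum_congr rfl fun k hk => ?_
      have hk0 : k ≠ 0 := by have := (Finset.mem_Icc.1 hk).1; omega
      exact sinhResidue_add_neg_three ![a, b, c] hα v 2 0 1 (by decide) (by decide) hk0
        (hca.sin_ne_zero hc hk0) (hcb.sin_ne_zero hc hk0)

/-! ### Difference equations in v -/

theorem two_pi_mul_add_half_div {a : ℝ} (ha : 0 < a) (v : ℝ) (k : ℕ) :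
    2 * Real.pi * k * ((v + a / 2) / a) = 2 * Real.pi * k * (v / a) + k * Real.pi := by
  field_simp

theorem two_pi_mul_sub_half_div {a : ℝ} (ha : 0 < a) (v : ℝ) (k : ℕ) :
    2 * Real.pi * k * ((v - a / 2) / a) = 2 * Real.pi * k * (v / a) - k * Real.pi := by
  field_simp

theorem sin_add_half_div {a : ℝ} (ha : 0 < a) (v : ℝ) (k : ℕ) :
    Real.sin (2 * Real.pi * k * ((v + a / 2) / a)) =
      (-1) ^ k * Real.sin (2 * Real.pi * k * (v / a)) := by
  rw [two_pi_mul_add_half_div ha, Real.sin_add_nat_mul_pi]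

theorem sin_sub_half_div {a : ℝ} (ha : 0 < a) (v : ℝ) (k : ℕ) :
    Real.sin (2 * Real.pi * k * ((v - a / 2) / a)) =
      (-1) ^ k * Real.sin (2 * Real.pi * k * (v / a)) := by
  rw [two_pi_mul_sub_half_div ha, Real.sin_sub_nat_mul_pi]

theorem cos_add_half_div {a : ℝ} (ha : 0 < a) (v : ℝ) (k : ℕ) :
    Real.cos (2 * Real.pi * k * ((v + a / 2) / a)) =
      (-1) ^ k * Real.cos (2 * Real.pi * k * (v / a)) := by
  rw [two_pi_mul_add_half_div ha, Real.cos_add_nat_mul_pi]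

theorem cos_sub_half_div {a : ℝ} (ha : 0 < a) (v : ℝ) (k : ℕ) :
    Real.cos (2 * Real.pi * k * ((v - a / 2) / a)) =
      (-1) ^ k * Real.cos (2 * Real.pi * k * (v / a)) := by
  rw [two_pi_mul_sub_half_div ha, Real.cos_sub_nat_mul_pi]

theorem oneSum_sub {a : ℝ} (ha : 0 < a) (v R : ℝ) :
    oneSum a (v + a / 2) R - oneSum a (v - a / 2) R = 1 := by
  have h : ∀ k, residuePairOne a (v + a / 2) k = residuePairOne a (v - a / 2) k := fun k => by
    rw [residuePairOne, residuePairOne, sin_add_half_div ha, sin_sub_half_div ha]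
  simp only [oneSum, h]
  field_simp
  ring

theorem two_pi_mul_add_div (a b v : ℝ) (k : ℕ) : 2 * Real.pi * k * ((v + a / 2) / b) =
    2 * Real.pi * k * (v / b) + Real.pi * k * a / b := by ring

theorem two_pi_mul_sub_div (a b v : ℝ) (k : ℕ) : 2 * Real.pi * k * ((v - a / 2) / b) =
    2 * Real.pi * k * (v / b) - Real.pi * k * a / b := by ring

/-- At a pole 2πik/a both shifts by ±a/2 only contribute the sign (-1)^k, so these residues cancel.
At a pole 2πik/b the difference produces the factor 2sinh(az/2), which cancels the one in the
denominator. The cut-off at R b is the same on both sides, so no limit is involved. -/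
theorem twoSum_sub {a b : ℝ} (ha : 0 < a) (hb : 0 < b) (hba : Incommensurable b a) (v R : ℝ) :
    twoSum a b (v + a / 2) R - twoSum a b (v - a / 2) R = oneSum b v R := by
  have h : ∀ k, residuePairTwo a b (v + a / 2) k = residuePairTwo a b (v - a / 2) k := fun k => by
    rw [residuePairTwo, residuePairTwo, cos_add_half_div ha, cos_sub_half_div ha]
  have h' : ∑ k ∈ Finset.Icc 1 ⌊R * b⌋₊, residuePairTwo b a (v + a / 2) k -
      ∑ k ∈ Finset.Icc 1 ⌊R * b⌋₊, residuePairTwo b a (v - a / 2) k =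
      ∑ k ∈ Finset.Icc 1 ⌊R * b⌋₊, residuePairOne b v k := by
    rw [← Finset.sum_sub_distrib]
    refine Finset.sum_congr rfl fun k hk => ?_
    have hk0 : k ≠ 0 := by have := (Finset.mem_Icc.1 hk).1; omega
    have hs := hba.sin_ne_zero hb hk0
    have hk' : (k : ℝ) ≠ 0 := by exact_mod_cast hk0
    have hp := Real.pi_ne_zero
    rw [residuePairTwo, residuePairTwo, residuePairOne, two_pi_mul_add_div, two_pi_mul_sub_div,
      Real.cos_add, Real.cos_sub]
    generalize Real.sin (Real.pi * k * a / b) = S at *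
    field_simp
    ring
  simp only [twoSum, h, oneSum, ← h']
  field_simp
  ring

theorem threeSum_sub {a b c : ℝ} (ha : 0 < a) (hb : 0 < b) (hc : 0 < c)
    (hba : Incommensurable b a) (hca : Incommensurable c a) (v R : ℝ) :
    threeSum a b c (v + a / 2) R - threeSum a b c (v - a / 2) R = twoSum b c v R := by
  have h : ∀ k, residuePairThree a b c (v + a / 2) k = residuePairThree a b c (v - a / 2) k :=
    fun k => by
      rw [residuePairThree, residuePairThree, sin_add_half_div ha, sin_sub_half_div ha]
  have h' : ∀ b c : ℝ, 0 < b → Incommensurable b a →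
      ∑ k ∈ Finset.Icc 1 ⌊R * b⌋₊, residuePairThree b a c (v + a / 2) k -
      ∑ k ∈ Finset.Icc 1 ⌊R * b⌋₊, residuePairThree b a c (v - a / 2) k =
      ∑ k ∈ Finset.Icc 1 ⌊R * b⌋₊, residuePairTwo b c v k := fun b c hb hba => by
    rw [← Finset.sum_sub_distrib]
    refine Finset.sum_congr rfl fun k hk => ?_
    have hk0 : k ≠ 0 := by have := (Finset.mem_Icc.1 hk).1; omega
    have hs := hba.sin_ne_zero hb hk0
    have hk' : (k : ℝ) ≠ 0 := by exact_mod_cast hk0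
    have hp := Real.pi_ne_zero
    rw [residuePairThree, residuePairThree, residuePairTwo, two_pi_mul_add_div,
      two_pi_mul_sub_div, Real.sin_add, Real.sin_sub]
    generalize Real.sin (Real.pi * k * a / b) = S at *
    generalize Real.sin (Real.pi * k * c / b) = U at *
    -- If U = 0 all the terms are divisions by zero, hence 0; otherwise U cancels as a common
    -- factor.
    by_cases hU : U = 0
    · simp [hU]
    field_simp
    ring
  simp only [threeSum, h, twoSum, ← h' b c hb hba, ← h' c b hc hca]
  field_simp
  ring

/-! ### Weighted counts as limits of residue sums -/

open Classical in
/-- The weight of a lattice point at distance `u ≥ 0` below the boundary: `1/2` on the boundary and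
`1` below it. -/
def boundaryWeight (u : ℝ) : ℝ := if u = 0 then 1 / 2 else 1

/-- The weighted number of `l` with `l c ≤ u`. -/
def oneCount (c u : ℝ) : ℝ := ∑ l ∈ Finset.range (⌊u / c⌋₊ + 1), boundaryWeight (u - l * c)

/-- The weighted number of `(q, l)` with `q b + l c ≤ u`. -/
def twoCount (b c u : ℝ) : ℝ := ∑ q ∈ Finset.range (⌊u / b⌋₊ + 1), oneCount c (u - q * b)

/-- The weighted number of `(p, q, l)` with `p a + q b + l c ≤ u`. -/
def threeCount (a b c u : ℝ) : ℝ := ∑ p ∈ Finset.range (⌊u / a⌋₊ + 1), twoCount b c (u - p * a)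

theorem eq_add_sum_of_sub_eq {F G : ℝ → ℝ} {a : ℝ}
    (h : ∀ v, F (v + a / 2) - F (v - a / 2) = G v) (w : ℝ) (P : ℕ) :
    F w = F (w - P * a) + ∑ p ∈ Finset.range P, G (w - p * a - a / 2) := by
  induction P with
  | zero => simp
  | succ P ih =>
    rw [Finset.sum_range_succ, ih, ← h (w - P * a - a / 2)]
    push_cast
    rw [show w - P * a - a / 2 + a / 2 = w - P * a by ring,
      show w - P * a - a / 2 - a / 2 = w - (P + 1) * a by ring]
    ring

theorem sub_mul_nonneg_of_mem_range {a u : ℝ} (ha : 0 < a) (hu : 0 ≤ u) {p : ℕ}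
    (hp : p ∈ Finset.range (⌊u / a⌋₊ + 1)) : 0 ≤ u - p * a := by
  have h1 : p ≤ ⌊u / a⌋₊ := by simpa [Nat.lt_succ_iff] using hp
  have h2 := (Nat.le_floor_iff (by positivity)).1 h1
  rw [le_div_iff₀ ha] at h2
  linarith

theorem sub_floor_mul_mem {a u : ℝ} (ha : 0 < a) (hu : 0 ≤ u) :
    -a ≤ u - (⌊u / a⌋₊ + 1 : ℕ) * a ∧ u - (⌊u / a⌋₊ + 1 : ℕ) * a < 0 := by
  have h1 := sub_mul_nonneg_of_mem_range ha hu (p := ⌊u / a⌋₊) (by simp)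
  have h2 := Nat.lt_floor_add_one (u / a)
  rw [div_lt_iff₀ ha] at h2
  push_cast
  constructor <;> linarith

theorem oneSum_half {a : ℝ} (ha : 0 < a) (R : ℝ) : oneSum a (a / 2) R = 1 / 2 := by
  have h : ∀ k, residuePairOne a (a / 2) k = 0 := fun k => by
    have := sin_add_half_div ha 0 k
    rw [zero_add] at this
    rw [residuePairOne, this]
    simp
  simp only [oneSum, h]
  field_simp
  simp

/-- On the edge of the range of decay every sine vanishes, so the value is exact for all R. This is
the origin of the weight 1/2 on the boundary. -/
theorem oneSum_neg_half {a : ℝ} (ha : 0 < a) (R : ℝ) : oneSum a (-(a / 2)) R = -(1 / 2) := by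
  have h := oneSum_sub ha 0 R
  rw [zero_add, zero_sub, oneSum_half ha] at h
  linarith

section Limits

variable {R : ℕ → ℝ} {a b c u : ℝ}

/-- ⌊u/a⌋ + 1 downward steps, each contributing 1, lead into [-a/2, a/2). Inside, the remainder
tends to 0; at the left endpoint, which means that a divides u, it equals -1/2. -/
theorem tendsto_oneSum (ha : 0 < a) (hu : 0 ≤ u) (hR : Tendsto R atTop atTop)
    (hRa : AvoidsPoles R a) :
    Tendsto (fun j => oneSum a (u + a / 2) (R j)) atTop (𝓝 (oneCount a u)) := by
  have hexp : ∀ j, oneSum a (u + a / 2) (R j) =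
      oneSum a (u + a / 2 - (⌊u / a⌋₊ + 1 : ℕ) * a) (R j) + (⌊u / a⌋₊ + 1 : ℕ) := fun j => by
    rw [eq_add_sum_of_sub_eq (F := fun v => oneSum a v (R j)) (G := fun _ => 1)
      (fun v => oneSum_sub ha v (R j)) (u + a / 2) (⌊u / a⌋₊ + 1)]
    simp
  simp only [hexp]
  obtain ⟨h1, h2⟩ := sub_floor_mul_mem ha hu
  have hlast : ∀ l ∈ Finset.range ⌊u / a⌋₊, boundaryWeight (u - l * a) = 1 := fun l hl => by
    have h3 : (l : ℝ) + 1 ≤ ⌊u / a⌋₊ := by exact_mod_cast Finset.mem_range.1 hl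
    have h4 := sub_mul_nonneg_of_mem_range ha hu (p := ⌊u / a⌋₊) (by simp)
    have h5 : u - l * a ≠ 0 := by nlinarith
    simp [boundaryWeight, h5]
  rw [oneCount, Finset.sum_range_succ, Finset.sum_congr rfl hlast]
  rcases h1.eq_or_lt with h | h
  · have h3 : u - ⌊u / a⌋₊ * a = 0 := by push_cast at h; linarith
    have h4 : u + a / 2 - (⌊u / a⌋₊ + 1 : ℕ) * a = -(a / 2) := by push_cast at h ⊢; linarith
    rw [h4]
    simp only [oneSum_neg_half ha, h3, boundaryWeight]
    refine tendsto_const_nhds.congr' (Eventually.of_forall fun _ => ?_)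
    push_cast
    simp
    ring
  · have h3 : u - ⌊u / a⌋₊ * a ≠ 0 := by push_cast at h; intro h'; linarith
    have h4 := (tendsto_oneSum_zero (v := u + a / 2 - (⌊u / a⌋₊ + 1 : ℕ) * a) ha
      (by rw [abs_lt]; constructor <;> linarith) hR hRa).add_const ((⌊u / a⌋₊ + 1 : ℕ) : ℝ)
    convert h4 using 2
    simp [boundaryWeight, h3]

/-- After the descent the argument lies in [(b-a)/2, (a+b)/2), strictly inside the range of decay
since b > 0, so no edge case arises here. The collected one-factor sums bring in the boundary
weights. -/
theorem tendsto_twoSum (ha : 0 < a) (hb : 0 < b) (hab : Incommensurable a b)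
    (hba : Incommensurable b a) (hu : 0 ≤ u) (hR : Tendsto R atTop atTop)
    (hRa : AvoidsPoles R a) (hRb : AvoidsPoles R b) :
    Tendsto (fun j => twoSum a b (u + (a + b) / 2) (R j)) atTop (𝓝 (twoCount a b u)) := by
  have hexp : ∀ j, twoSum a b (u + (a + b) / 2) (R j) =
      twoSum a b (u + (a + b) / 2 - (⌊u / a⌋₊ + 1 : ℕ) * a) (R j) +
        ∑ p ∈ Finset.range (⌊u / a⌋₊ + 1), oneSum b (u - p * a + b / 2) (R j) := fun j => by
    rw [eq_add_sum_of_sub_eq (F := fun v => twoSum a b v (R j))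
      (fun v => twoSum_sub ha hb hba v (R j)) (u + (a + b) / 2) (⌊u / a⌋₊ + 1)]
    congr 1
    exact Finset.sum_congr rfl fun p _ => by ring_nf
  simp only [hexp]
  obtain ⟨h1, h2⟩ := sub_floor_mul_mem ha hu
  rw [twoCount, ← zero_add (Finset.sum _ _)]
  refine (tendsto_twoSum_zero ha hb hab hba ?_ hR hRa hRb).add
    (tendsto_finsetSum _ fun p hp =>
      tendsto_oneSum hb (sub_mul_nonneg_of_mem_range ha hu hp) hR hRb)
  rw [abs_lt]
  constructor <;> linarith

theorem tendsto_threeSum (ha : 0 < a) (hb : 0 < b) (hc : 0 < c)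
    (hab : Incommensurable a b) (hba : Incommensurable b a) (hac : Incommensurable a c)
    (hca : Incommensurable c a) (hbc : Incommensurable b c) (hcb : Incommensurable c b)
    (hu : 0 ≤ u) (hR : Tendsto R atTop atTop)
    (hRa : AvoidsPoles R a) (hRb : AvoidsPoles R b) (hRc : AvoidsPoles R c) :
    Tendsto (fun j => threeSum a b c (u + (a + b + c) / 2) (R j)) atTop
      (𝓝 (threeCount a b c u)) := by
  have hexp : ∀ j, threeSum a b c (u + (a + b + c) / 2) (R j) =
      threeSum a b c (u + (a + b + c) / 2 - (⌊u / a⌋₊ + 1 : ℕ) * a) (R j) +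
        ∑ p ∈ Finset.range (⌊u / a⌋₊ + 1), twoSum b c (u - p * a + (b + c) / 2) (R j) :=
    fun j => by
      rw [eq_add_sum_of_sub_eq (F := fun v => threeSum a b c v (R j))
        (fun v => threeSum_sub ha hb hc hba hca v (R j)) (u + (a + b + c) / 2) (⌊u / a⌋₊ + 1)]
      congr 1
      exact Finset.sum_congr rfl fun p _ => by ring_nf
  simp only [hexp]
  obtain ⟨h1, h2⟩ := sub_floor_mul_mem ha hu
  rw [threeCount, ← zero_add (Finset.sum _ _)]
  refine (tendsto_threeSum_zero ha hb hc hab hba hac hca hbc hcb ?_ hR hRa hRb hRc).add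
    (tendsto_finsetSum _ fun p hp =>
      tendsto_twoSum hb hc hbc hcb (sub_mul_nonneg_of_mem_range ha hu hp) hR hRb hRc)
  rw [abs_lt]
  constructor <;> linarith

/-- The residue sums with two factors converge also at the reflected argument. -/
theorem exists_tendsto_twoSum_sub (ha : 0 < a) (hb : 0 < b) (hab : Incommensurable a b)
    (hba : Incommensurable b a) (hu : 0 ≤ u) (hR : Tendsto R atTop atTop)
    (hRa : AvoidsPoles R a) (hRb : AvoidsPoles R b) :
    ∃ l, Tendsto (fun j => twoSum a b (u - (a + b) / 2) (R j)) atTop (𝓝 l) := by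
  rcases hu.eq_or_lt with rfl | hu'
  -- For u = 0 the argument is on the edge. One step up by a leads to (a-b)/2, inside the range of
  -- decay, at the cost of the exact value -1/2.
  · have hexp : ∀ j, twoSum a b (0 - (a + b) / 2) (R j) =
        twoSum a b ((a - b) / 2) (R j) + 1 / 2 := fun j => by
      have h := twoSum_sub ha hb hba (-(b / 2)) (R j)
      rw [oneSum_neg_half hb, show -(b / 2) + a / 2 = (a - b) / 2 by ring,
        show -(b / 2) - a / 2 = 0 - (a + b) / 2 by ring] at h
      linarith
    simp only [hexp]
    exact ⟨_, (tendsto_twoSum_zero ha hb hab hba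
      (by rw [abs_lt]; constructor <;> linarith) hR hRa hRb).add_const _⟩
  · rcases lt_or_ge u (a + b) with h | h
    · exact ⟨_, tendsto_twoSum_zero ha hb hab hba
        (by rw [abs_lt]; constructor <;> linarith) hR hRa hRb⟩
    · have := tendsto_twoSum (u := u - (a + b)) ha hb hab hba (by linarith) hR hRa hRb
      rw [show u - (a + b) + (a + b) / 2 = u - (a + b) / 2 by ring] at this
      exact ⟨_, this⟩

end Limits

/-! ### Sawtooth form of the one-dimensional count -/

theorem oneCount_eq {a u : ℝ} (ha : 0 < a) (hu : 0 ≤ u) :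
    oneCount a u = u / a + 1 / 2 - bernoulliOneStar (u / a) := by
  have hlast : ∀ l ∈ Finset.range ⌊u / a⌋₊, boundaryWeight (u - l * a) = 1 := fun l hl => by
    have h3 : (l : ℝ) + 1 ≤ ⌊u / a⌋₊ := by exact_mod_cast Finset.mem_range.1 hl
    have h4 := sub_mul_nonneg_of_mem_range ha hu (p := ⌊u / a⌋₊) (by simp)
    have h5 : u - l * a ≠ 0 := by nlinarith
    simp [boundaryWeight, h5]
  rw [oneCount, Finset.sum_range_succ, Finset.sum_congr rfl hlast]
  have hua : 0 ≤ u / a := by positivity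
  have hfl : (⌊u / a⌋₊ : ℝ) = u / a - Int.fract (u / a) := by
    rw [natCast_floor_eq_intCast_floor hua]
    exact (Int.self_sub_fract _).symm
  have hfr : u - ⌊u / a⌋₊ * a = Int.fract (u / a) * a := by
    rw [hfl]; field_simp; ring
  rw [boundaryWeight, bernoulliOneStar, hfr]
  by_cases h : ∃ m : ℤ, (m : ℝ) = u / a
  · have h0 : Int.fract (u / a) = 0 := by
      obtain ⟨m, hm⟩ := h
      rw [← hm, Int.fract_intCast]
    rw [if_pos h, if_pos (by rw [h0, zero_mul])]
    simp [hfl, h0]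
  · have h0 : Int.fract (u / a) ≠ 0 := fun h0 => h (by
      obtain ⟨m, hm⟩ := Int.fract_eq_zero_iff.1 h0
      exact ⟨m, hm⟩)
    rw [if_neg h, if_neg (mul_ne_zero h0 ha.ne')]
    simp only [Finset.sum_const, Finset.card_range, nsmul_eq_mul, mul_one, hfl]
    ring

/-! ### Irrational ratios and the choice of radii -/

theorem incommensurable_log {p q : ℕ} (hp : p.Prime) (hq : q.Prime) (hpq : p ≠ q) :
    Incommensurable (Real.log p) (Real.log q) := fun m n hm h => by
  have hlp : 0 < Real.log p := Real.log_pos (by exact_mod_cast hp.one_lt)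
  have hlq : 0 < Real.log q := Real.log_pos (by exact_mod_cast hq.one_lt)
  have h1 : (m.natAbs : ℝ) * Real.log q = n.natAbs * Real.log p := by
    have := congrArg abs h
    rw [abs_mul, abs_mul, abs_of_pos hlp, abs_of_pos hlq] at this
    rwa [Nat.cast_natAbs, Nat.cast_natAbs, Int.cast_abs, Int.cast_abs]
  rw [← Real.log_pow, ← Real.log_pow] at h1
  have h2 : (q : ℝ) ^ m.natAbs = (p : ℝ) ^ n.natAbs :=
    Real.log_injOn_pos (Set.mem_Ioi.2 (by have := hq.pos; positivity))
      (Set.mem_Ioi.2 (by have := hp.pos; positivity)) h1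
  have h3 : q ^ m.natAbs = p ^ n.natAbs := by exact_mod_cast h2
  have h4 : q ∣ p ^ n.natAbs := h3 ▸ dvd_pow_self q (Int.natAbs_ne_zero.2 hm)
  exact hpq ((Nat.prime_dvd_prime_iff_eq hq hp).1 (hq.dvd_of_dvd_pow h4)).symm

/-- With y the difference of a r and the nearest integer, |y| ≤ 1/2, and concavity of the sine gives
|sin(πy)| ≥ 2|y|. -/
theorem le_abs_sin_of_forall_le_abs_sub {a r δ : ℝ} (ha : 0 < a)
    (h : ∀ n : ℤ, δ ≤ |r - n / a|) : 2 * a * δ ≤ |Real.sin (Real.pi * a * r)| := by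
  set n := round (a * r)
  have h1 : |a * r - n| ≤ 1 / 2 := abs_sub_round _
  have h2 : a * δ ≤ |a * r - n| := by
    have h3 : a * r - n = a * (r - n / a) := by field_simp
    rw [h3, abs_mul, abs_of_pos ha]
    exact mul_le_mul_of_nonneg_left (h n) ha.le
  have h3 : |Real.sin (Real.pi * a * r)| = |Real.sin (Real.pi * (a * r - n))| := by
    rw [show Real.pi * (a * r - n) = Real.pi * a * r - n * Real.pi by ring,
      Real.sin_sub_int_mul_pi, abs_mul, abs_zpow]
    simp
  have h4 := Real.mul_abs_le_abs_sin (x := Real.pi * (a * r - n)) (by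
    rw [abs_mul, abs_of_pos Real.pi_pos]
    nlinarith [Real.pi_pos])
  rw [abs_mul, abs_of_pos Real.pi_pos, ← mul_assoc, div_mul_cancel₀ _ Real.pi_ne_zero] at h4
  rw [h3]
  linarith

/-- Among four equally spaced points, one stays away from three sparse arithmetic progressions. -/
theorem exists_forall_le_abs_sub (α : Fin 3 → ℝ) (hα : ∀ i, 0 < α i) (hα2 : ∀ i, α i ≤ 2)
    (r : ℝ) : ∃ m : Fin 4, ∀ i, ∀ n : ℤ, 1 / 16 ≤ |r + (m : ℕ) / 8 - n / α i| := by
  by_contra! hcon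
  choose i n hn using hcon
  -- Pigeonhole: two of the four points are close to the same progression, whose gaps are at least
  -- 1/2. Close to the same term they would be less than 1/8 apart, close to different terms more
  -- than 3/8; but their distance is between 1/8 and 3/8.
  obtain ⟨m, m', hne, him⟩ := Fintype.exists_ne_map_eq_of_card_lt i (by simp)
  have h1 := abs_lt.1 (hn m)
  have h2 := abs_lt.1 (hn m')
  rw [← him] at h2
  have hm : (m : ℕ) ≤ 3 := by omega
  have hm' : (m' : ℕ) ≤ 3 := by omega
  have hm3 : ((m : ℕ) : ℝ) ≤ 3 := by exact_mod_cast hm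
  have hm3' : ((m' : ℕ) : ℝ) ≤ 3 := by exact_mod_cast hm'
  have hm0 : (0 : ℝ) ≤ (m : ℕ) := Nat.cast_nonneg _
  have hm0' : (0 : ℝ) ≤ (m' : ℕ) := Nat.cast_nonneg _
  have ha := hα (i m)
  have ha2 := hα2 (i m)
  have hstep : ∀ k l : ℤ, k + 1 ≤ l → (k : ℝ) / α (i m) + 1 / 2 ≤ l / α (i m) := fun k l hkl => by
    have h3 : (k : ℝ) + 1 ≤ l := by exact_mod_cast hkl
    have h4 : 1 / 2 ≤ 1 / α (i m) := one_div_le_one_div_of_le ha ha2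
    calc (k : ℝ) / α (i m) + 1 / 2 ≤ k / α (i m) + 1 / α (i m) := by linarith
      _ = (k + 1) / α (i m) := by ring
      _ ≤ l / α (i m) := by gcongr
  rcases lt_trichotomy (n m) (n m') with h | h | h
  · have := hstep _ _ h
    linarith [h1.1, h1.2, h2.1, h2.2]
  · rw [h] at h1
    have hv : (m : ℕ) ≠ m' := fun h => hne (Fin.ext h)
    rcases lt_or_gt_of_ne hv with h' | h'
    · have : ((m : ℕ) : ℝ) + 1 ≤ (m' : ℕ) := by exact_mod_cast h'
      linarith [h1.1, h1.2, h2.1, h2.2]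
    · have : ((m' : ℕ) : ℝ) + 1 ≤ (m : ℕ) := by exact_mod_cast h'
      linarith [h1.1, h1.2, h2.1, h2.2]
  · have := hstep _ _ h
    linarith [h1.1, h1.2, h2.1, h2.2]

theorem exists_tendsto_avoidsPoles (α : Fin 3 → ℝ) (hα : ∀ i, 0 < α i) (hα2 : ∀ i, α i ≤ 2) :
    ∃ R : ℕ → ℝ, Tendsto R atTop atTop ∧ ∀ i, AvoidsPoles R (α i) := by
  choose m hm using fun j : ℕ => exists_forall_le_abs_sub α hα hα2 j
  refine ⟨fun j => j + (m j : ℕ) / 8, ?_, fun i => ⟨2 * α i * (1 / 16), ?_, fun j => ?_⟩⟩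
  · exact tendsto_atTop_mono (fun j => le_add_of_nonneg_right (by positivity))
      tendsto_natCast_atTop_atTop
  · have := hα i
    positivity
  · exact le_abs_sin_of_forall_le_abs_sub (hα i) (hm j i)

/-! ### The weighted count and smooth numbers -/

theorem mem_range_floor_iff {a u : ℝ} (ha : 0 < a) (hu : 0 ≤ u) (p : ℕ) :
    p ∈ Finset.range (⌊u / a⌋₊ + 1) ↔ 0 ≤ u - p * a := by
  rw [Finset.mem_range, Nat.lt_succ_iff, Nat.le_floor_iff (by positivity), le_div_iff₀ ha,
    sub_nonneg]

theorem pow_two_three_five_injective {p q l p' q' l' : ℕ}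
    (h : 2 ^ p * 3 ^ q * 5 ^ l = 2 ^ p' * 3 ^ q' * 5 ^ l') : p = p' ∧ q = q' ∧ l = l' := by
  have key : ∀ p q l : ℕ, (2 ^ p * 3 ^ q * 5 ^ l).factorization =
      Finsupp.single 2 p + Finsupp.single 3 q + Finsupp.single 5 l := fun p q l => by
    rw [Nat.factorization_mul (by positivity) (by positivity),
      Nat.factorization_mul (by positivity) (by positivity), Nat.prime_two.factorization_pow,
      Nat.prime_three.factorization_pow, Nat.prime_five.factorization_pow]
  have h' := congrArg Nat.factorization h
  rw [key, key] at h'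
  exact ⟨by simpa using DFunLike.congr_fun h' 2, by simpa using DFunLike.congr_fun h' 3,
    by simpa using DFunLike.congr_fun h' 5⟩

theorem log_smooth (p q l : ℕ) : Real.log ((2 : ℝ) ^ p * 3 ^ q * 5 ^ l) =
    p * Real.log 2 + q * Real.log 3 + l * Real.log 5 := by
  rw [Real.log_mul (by positivity) (by positivity), Real.log_mul (by positivity) (by positivity),
    Real.log_pow, Real.log_pow, Real.log_pow]

/-- A triple loses weight 1/2 exactly when its product equals x, and unique factorization allows at
most one such triple. -/
theorem threeCount_eq {x : ℝ} (hx : 1 ≤ x) :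
    threeCount (Real.log 2) (Real.log 3) (Real.log 5) (Real.log x) =
      smoothCount 2 3 5 x - 1 / 2 * smoothChi 2 3 5 x := by
  classical
  have hx0 : 0 < x := by linarith
  have hu : 0 ≤ Real.log x := Real.log_nonneg hx
  have h2 : 0 < Real.log 2 := Real.log_pos (by norm_num)
  have h3 : 0 < Real.log 3 := Real.log_pos (by norm_num)
  have h5 : 0 < Real.log 5 := Real.log_pos (by norm_num)
  set u := Real.log x with hu_def
  set S : Finset (Σ _ : ℕ, Σ _ : ℕ, ℕ) := (Finset.range (⌊u / Real.log 2⌋₊ + 1)).sigma fun p =>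
    (Finset.range (⌊(u - p * Real.log 2) / Real.log 3⌋₊ + 1)).sigma fun q =>
      Finset.range (⌊(u - p * Real.log 2 - q * Real.log 3) / Real.log 5⌋₊ + 1) with hS
  set d : (Σ _ : ℕ, Σ _ : ℕ, ℕ) → ℝ := fun t =>
    u - t.1 * Real.log 2 - t.2.1 * Real.log 3 - t.2.2 * Real.log 5 with hd
  have hsum : threeCount (Real.log 2) (Real.log 3) (Real.log 5) u =
      ∑ t ∈ S, boundaryWeight (d t) := by
    simp only [hS, Finset.sum_sigma, threeCount, twoCount, oneCount, hd]
  have hd_log : ∀ t, d t = Real.log x - Real.log ((2 : ℝ) ^ t.1 * 3 ^ t.2.1 * 5 ^ t.2.2) :=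
    fun t => by
      rw [log_smooth, ← hu_def]; simp only [hd]; ring
  have hmem : ∀ t, t ∈ S ↔ 0 ≤ d t := fun t => by
    rw [hS, Finset.mem_sigma, Finset.mem_sigma, mem_range_floor_iff h2 hu]
    constructor
    · rintro ⟨h, h', h''⟩
      have e := (mem_range_floor_iff h3 h _).1 h'
      exact (mem_range_floor_iff h5 e _).1 h''
    · intro h
      have e3 : 0 ≤ u - t.1 * Real.log 2 - t.2.1 * Real.log 3 := by
        have : 0 ≤ (t.2.2 : ℝ) * Real.log 5 := by positivity
        simp only [hd] at h
        linarith
      have e2 : 0 ≤ u - t.1 * Real.log 2 := by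
        have : 0 ≤ (t.2.1 : ℝ) * Real.log 3 := by positivity
        linarith
      exact ⟨e2, (mem_range_floor_iff h3 e2 _).2 e3, (mem_range_floor_iff h5 e3 _).2 h⟩
  have hcount : smoothCount 2 3 5 x = S.card := by
    rw [smoothCount, ← Set.ncard_coe_finset S]
    have hinj : Function.Injective
        (fun t : (Σ _ : ℕ, Σ _ : ℕ, ℕ) => (t.1, t.2.1, t.2.2)) := by
      rintro ⟨p, q, l⟩ ⟨p', q', l'⟩ h
      simp only [Prod.mk.injEq] at h
      obtain ⟨rfl, rfl, rfl⟩ := h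
      rfl
    rw [← Set.ncard_image_of_injective (S : Set _) hinj]
    congr 1
    ext ⟨p, q, l⟩
    simp only [Set.mem_ofPred_eq, Set.mem_image, SetLike.mem_coe, Prod.mk.injEq]
    have hiff : ((2 : ℕ) : ℝ) ^ p * ((3 : ℕ) : ℝ) ^ q * ((5 : ℕ) : ℝ) ^ l ≤ x ↔
        (⟨p, q, l⟩ : Σ _ : ℕ, Σ _ : ℕ, ℕ) ∈ S := by
      rw [hmem, hd_log, sub_nonneg, Real.log_le_log_iff (by positivity) hx0]
      norm_num
    rw [hiff]
    constructor
    · exact fun h => ⟨_, h, rfl, rfl, rfl⟩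
    · rintro ⟨⟨p', q', l'⟩, h, rfl, rfl, rfl⟩
      exact h
  clear_value S d
  have hweight : ∀ t, boundaryWeight (d t) = 1 - 1 / 2 * (if d t = 0 then 1 else 0) := fun t => by
    rw [boundaryWeight]
    split_ifs <;> norm_num
  have hd0 : ∀ t, d t = 0 ↔ ((2 ^ t.1 * 3 ^ t.2.1 * 5 ^ t.2.2 : ℕ) : ℝ) = x := fun t => by
    rw [hd_log, sub_eq_zero, eq_comm]
    push_cast
    exact ⟨fun h => Real.log_injOn_pos (Set.mem_Ioi.2 (by positivity)) (Set.mem_Ioi.2 hx0) h,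
      fun h => by rw [h]⟩
  have hchi : (∑ t ∈ S, if d t = 0 then (1 : ℝ) else 0) = smoothChi 2 3 5 x := by
    rw [smoothChi]
    split_ifs with hex
    · obtain ⟨n, ⟨p, q, l, hnat⟩, hn⟩ := hex
      rw [hnat] at hn
      have h0 : d ⟨p, q, l⟩ = 0 := by
        rw [hd0]
        exact hn
      have hS0 : ⟨p, q, l⟩ ∈ S := by rw [hmem, h0]
      rw [Finset.sum_eq_single_of_mem _ hS0, if_pos h0]
      rintro ⟨p', q', l'⟩ _ hne
      refine if_neg fun h => hne ?_
      rw [hd0, ← hn, Nat.cast_inj] at h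
      obtain ⟨rfl, rfl, rfl⟩ := pow_two_three_five_injective h
      rfl
    · refine Finset.sum_eq_zero fun t _ => if_neg fun h => hex ?_
      exact ⟨_, ⟨t.1, t.2.1, t.2.2, rfl⟩, (hd0 t).1 h⟩
  rw [hsum, Finset.sum_congr rfl fun t _ => hweight t, Finset.sum_sub_distrib, ← Finset.mul_sum,
    hchi, hcount]
  simp

/-! ### From residues to the cosine and sine series -/

section Series

variable {a b c : ℕ} {x R : ℝ}

theorem residuePairOne_add_half (ha : 0 < Real.log a) (u : ℝ) (k : ℕ) :
    residuePairOne (Real.log a) (u + Real.log a / 2) k =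
      Real.sin (2 * Real.pi * k * (u / Real.log a)) / (Real.pi * k) := by
  rw [residuePairOne, sin_add_half_div ha, ← mul_assoc, ← mul_pow]
  simp

/-- The shift by half of log a absorbs the sign (-1)^k, leaving the shift by half of log b. This is
why the reflected argument is the right one for the cosine series. -/
theorem residuePairTwo_eq_cosTerm (ha : 0 < Real.log a) (k : ℕ) :
    residuePairTwo (Real.log a) (Real.log b) (Real.log x - (Real.log a + Real.log b) / 2) k =
      -(1 / (2 * Real.pi)) * cosTerm a b x k := by
  rw [residuePairTwo, show Real.log x - (Real.log a + Real.log b) / 2 =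
    (Real.log x - 1 / 2 * Real.log b) - Real.log a / 2 by ring, cos_sub_half_div ha, ← mul_assoc,
    ← mul_pow, cosTerm]
  ring

theorem twoSum_eq_sub_cosPairSum (ha : 0 < Real.log a) (hb : 0 < Real.log b) :
    twoSum (Real.log a) (Real.log b) (Real.log x - (Real.log a + Real.log b) / 2) R =
      ((Real.log x - (Real.log a + Real.log b) / 2) ^ 2 / 2 -
        (Real.log a ^ 2 + Real.log b ^ 2) / 24) / (Real.log a * Real.log b) -
      1 / (2 * Real.pi) * cosPairSum a b x R := by
  rw [twoSum, cosPairSum, Finset.sum_congr rfl fun k _ => residuePairTwo_eq_cosTerm ha k,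
    add_comm (Real.log a) (Real.log b),
    Finset.sum_congr rfl fun k _ => residuePairTwo_eq_cosTerm hb k,
    ← Finset.mul_sum, ← Finset.mul_sum]
  ring

/-- With θ = 2πk log x/log a, φ = πk log b/log a and ψ = πk log c/log a, this is sin(θ+φ+ψ) =
cos(θ-φ) sin ψ + cos(θ-ψ) sin φ + sin θ cos(φ-ψ) - 4 sin θ sin φ sin ψ, divided by -4πk sin φ sin ψ.
-/
theorem residuePairThree_eq (ha : 0 < Real.log a)
    (hab : Incommensurable (Real.log a) (Real.log b))
    (hac : Incommensurable (Real.log a) (Real.log c)) {k : ℕ} (hk : k ≠ 0) :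
    residuePairThree (Real.log a) (Real.log b) (Real.log c)
        (Real.log x + (Real.log a + Real.log b + Real.log c) / 2) k =
      residuePairOne (Real.log a) (Real.log x + Real.log a / 2) k -
        1 / (4 * Real.pi) * (cosTerm a b x k + cosTerm a c x k) -
        1 / (8 * Real.pi) * sinTerm a b c x k := by
  have hk' : (k : ℝ) ≠ 0 := by exact_mod_cast hk
  have hp := Real.pi_ne_zero
  have hs := hab.sin_ne_zero ha hk
  have ht := hac.sin_ne_zero ha hk
  have hcs := Real.sin_sq_add_cos_sq (Real.pi * k * Real.log b / Real.log a)
  have hct := Real.sin_sq_add_cos_sq (Real.pi * k * Real.log c / Real.log a)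
  have hA : ∀ s t : ℝ, 2 * Real.pi * k *
      ((Real.log x + s * Real.log b + t * Real.log c) / Real.log a) =
      2 * Real.pi * k * (Real.log x / Real.log a) +
        (2 * s) * (Real.pi * k * Real.log b / Real.log a) +
        (2 * t) * (Real.pi * k * Real.log c / Real.log a) := fun s t => by ring
  rw [residuePairOne_add_half ha, residuePairThree,
    show Real.log x + (Real.log a + Real.log b + Real.log c) / 2 =
      (Real.log x + 1 / 2 * Real.log b + 1 / 2 * Real.log c) + Real.log a / 2 by ring,
    sin_add_half_div ha, ← mul_assoc ((-1 : ℝ) ^ k), ← mul_pow, cosTerm, cosTerm, sinTerm,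
    show Real.log x - 1 / 2 * Real.log b =
      Real.log x + (-1 / 2) * Real.log b + 0 * Real.log c by ring,
    show Real.log x - 1 / 2 * Real.log c =
      Real.log x + 0 * Real.log b + (-1 / 2) * Real.log c by ring,
    show Real.log x + 1 / 2 * Real.log b - 1 / 2 * Real.log c =
      Real.log x + 1 / 2 * Real.log b + (-1 / 2) * Real.log c by ring,
    show Real.log x + (-1 / 2) * Real.log b + 0 * Real.log c + 1 / 2 * Real.log c =
      Real.log x + (-1 / 2) * Real.log b + 1 / 2 * Real.log c by ring]
  simp only [hA]
  generalize Real.pi * k * Real.log b / Real.log a = φ at *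
  generalize Real.pi * k * Real.log c / Real.log a = ψ at *
  generalize 2 * Real.pi * k * (Real.log x / Real.log a) = θ at *
  rw [show θ + 2 * (1 / 2) * φ + 2 * (1 / 2) * ψ = θ + (φ + ψ) by ring,
    show θ + 2 * (-1 / 2) * φ + 2 * 0 * ψ = θ - φ by ring,
    show θ + 2 * 0 * φ + 2 * (-1 / 2) * ψ = θ - ψ by ring,
    show θ + 2 * (1 / 2) * φ + 2 * (-1 / 2) * ψ = θ + (φ - ψ) by ring,
    show θ + 2 * (-1 / 2) * φ + 2 * (1 / 2) * ψ = θ - (φ - ψ) by ring]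
  simp only [Real.sin_add, Real.sin_sub, Real.cos_add, Real.cos_sub]
  field_simp
  ring

theorem threeSum_eq (ha : 0 < Real.log a) (hb : 0 < Real.log b) (hc : 0 < Real.log c)
    (hab : Incommensurable (Real.log a) (Real.log b))
    (hba : Incommensurable (Real.log b) (Real.log a))
    (hac : Incommensurable (Real.log a) (Real.log c))
    (hca : Incommensurable (Real.log c) (Real.log a))
    (hbc : Incommensurable (Real.log b) (Real.log c))
    (hcb : Incommensurable (Real.log c) (Real.log b)) {v : ℝ}
    (hv : v = Real.log x + (Real.log a + Real.log b + Real.log c) / 2) :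
    threeSum (Real.log a) (Real.log b) (Real.log c) v R =
      (v ^ 3 / 6 - v * (Real.log a ^ 2 + Real.log b ^ 2 + Real.log c ^ 2) / 24) /
        (Real.log a * Real.log b * Real.log c) +
      (oneSum (Real.log a) (Real.log x + Real.log a / 2) R -
        (Real.log x + Real.log a / 2) / Real.log a) +
      (oneSum (Real.log b) (Real.log x + Real.log b / 2) R -
        (Real.log x + Real.log b / 2) / Real.log b) +
      (oneSum (Real.log c) (Real.log x + Real.log c / 2) R -
        (Real.log x + Real.log c / 2) / Real.log c) -
      1 / (4 * Real.pi) * cosPairSum a b x R - 1 / (4 * Real.pi) * cosPairSum b c x R -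
      1 / (4 * Real.pi) * cosPairSum c a x R -
      1 / (8 * Real.pi) * (sinSum a b c x R + sinSum b a c x R + sinSum c a b x R) := by
  have hsum : ∀ a b c : ℕ, 0 < Real.log a → Incommensurable (Real.log a) (Real.log b) →
      Incommensurable (Real.log a) (Real.log c) →
      Real.log x + (Real.log a + Real.log b + Real.log c) / 2 = v →
      ∑ k ∈ Finset.Icc 1 ⌊R * Real.log a⌋₊,
        residuePairThree (Real.log a) (Real.log b) (Real.log c) v k =
      ∑ k ∈ Finset.Icc 1 ⌊R * Real.log a⌋₊,
        residuePairOne (Real.log a) (Real.log x + Real.log a / 2) k -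
      1 / (4 * Real.pi) * (∑ k ∈ Finset.Icc 1 ⌊R * Real.log a⌋₊, cosTerm a b x k +
        ∑ k ∈ Finset.Icc 1 ⌊R * Real.log a⌋₊, cosTerm a c x k) -
      1 / (8 * Real.pi) * sinSum a b c x R := fun a b c ha hab hac hv' => by
    rw [sinSum, ← Finset.sum_add_distrib, Finset.mul_sum, Finset.mul_sum,
      ← Finset.sum_sub_distrib, ← Finset.sum_sub_distrib, ← hv']
    refine Finset.sum_congr rfl fun k hk => ?_
    exact residuePairThree_eq ha hab hac (by have := (Finset.mem_Icc.1 hk).1; omega)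
  rw [threeSum, hsum a b c ha hab hac hv.symm, hsum b a c hb hba hbc (by rw [hv]; ring),
    hsum c a b hc hca hcb (by rw [hv]; ring)]
  simp only [oneSum, cosPairSum]
  ring

end Series

theorem exists_tendsto_cosPairSum {a b : ℕ} (ha : 0 < Real.log a) (hb : 0 < Real.log b)
    (hab : Incommensurable (Real.log a) (Real.log b))
    (hba : Incommensurable (Real.log b) (Real.log a)) {x : ℝ} (hx : 1 ≤ x) {R : ℕ → ℝ}
    (hR : Tendsto R atTop atTop) (hRa : AvoidsPoles R (Real.log a))
    (hRb : AvoidsPoles R (Real.log b)) :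
    ∃ l, Tendsto (fun j => cosPairSum a b x (R j)) atTop (𝓝 l) := by
  obtain ⟨l, hl⟩ := exists_tendsto_twoSum_sub ha hb hab hba (Real.log_nonneg hx) hR hRa hRb
  simp only [twoSum_eq_sub_cosPairSum ha hb] at hl
  have hp := Real.pi_ne_zero
  refine ⟨_, ((hl.const_sub (((Real.log x - (Real.log a + Real.log b) / 2) ^ 2 / 2 -
        (Real.log a ^ 2 + Real.log b ^ 2) / 24) / (Real.log a * Real.log b))).const_mul
          (2 * Real.pi)).congr fun j => ?_⟩
  rw [sub_sub_cancel]
  field_simp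

end

/-! ### Assembly of the formula -/

theorem corollary8 :
    ∃ R : ℕ → ℝ, Tendsto R atTop atTop ∧
      ∀ x : ℝ, 1 ≤ x →
        ∃ C₂₃ C₃₅ C₅₂ D : ℝ,
          Tendsto (fun j => cosPairSum 2 3 x (R j)) atTop (𝓝 C₂₃) ∧
          Tendsto (fun j => cosPairSum 3 5 x (R j)) atTop (𝓝 C₃₅) ∧
          Tendsto (fun j => cosPairSum 5 2 x (R j)) atTop (𝓝 C₅₂) ∧
          Tendsto (fun j => sinSum 2 3 5 x (R j) + sinSum 3 2 5 x (R j) + sinSum 5 2 3 x (R j))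
            atTop (𝓝 D) ∧
          (smoothCount 2 3 5 x : ℝ) =
            Real.log x ^ 3 / (6 * Real.log 2 * Real.log 3 * Real.log 5)
            + Real.log x ^ 2 / (4 * Real.log 2 * Real.log 3)
            + Real.log x ^ 2 / (4 * Real.log 2 * Real.log 5)
            + Real.log x ^ 2 / (4 * Real.log 3 * Real.log 5)
            + Real.log x / (4 * Real.log 2)
            + Real.log x / (4 * Real.log 3)
            + Real.log x / (4 * Real.log 5)
            + Real.log 2 * Real.log x / (12 * Real.log 3 * Real.log 5)
            + Real.log 3 * Real.log x / (12 * Real.log 2 * Real.log 5)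
            + Real.log 5 * Real.log x / (12 * Real.log 2 * Real.log 3)
            + Real.log 2 / (24 * Real.log 3) + Real.log 2 / (24 * Real.log 5)
            + Real.log 3 / (24 * Real.log 2) + Real.log 3 / (24 * Real.log 5)
            + Real.log 5 / (24 * Real.log 2) + Real.log 5 / (24 * Real.log 3)
            + 1 / 8
            - bernoulliOneStar (Real.log x / Real.log 2)
            - bernoulliOneStar (Real.log x / Real.log 3)
            - bernoulliOneStar (Real.log x / Real.log 5)
            - 1 / (4 * Real.pi) * C₂₃
            - 1 / (4 * Real.pi) * C₃₅
            - 1 / (4 * Real.pi) * C₅₂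
            - 1 / (8 * Real.pi) * D
            + 1 / 2 * smoothChi 2 3 5 x := by
  have h2 : 0 < Real.log (2 : ℕ) := Real.log_pos (by norm_num)
  have h3 : 0 < Real.log (3 : ℕ) := Real.log_pos (by norm_num)
  have h5 : 0 < Real.log (5 : ℕ) := Real.log_pos (by norm_num)
  -- True since e² > 5. The bound 2 guarantees the gaps of at least 1/2 used in the choice of the
  -- radii.
  have h5le : Real.log (5 : ℕ) ≤ 2 := by
    rw [Real.log_le_iff_le_exp (by norm_num), show (2 : ℝ) = 1 + 1 by norm_num, Real.exp_add]
    have := Real.exp_one_gt_d9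
    push_cast
    nlinarith
  have h2le : Real.log (2 : ℕ) ≤ 2 :=
    (Real.log_le_log (by norm_num) (by norm_num)).trans h5le
  have h3le : Real.log (3 : ℕ) ≤ 2 :=
    (Real.log_le_log (by norm_num) (by norm_num)).trans h5le
  have p2 := Nat.prime_two
  have p3 := Nat.prime_three
  have p5 := Nat.prime_five
  have h23 := incommensurable_log p2 p3 (by norm_num)
  have h32 := incommensurable_log p3 p2 (by norm_num)
  have h25 := incommensurable_log p2 p5 (by norm_num)
  have h52 := incommensurable_log p5 p2 (by norm_num)
  have h35 := incommensurable_log p3 p5 (by norm_num)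
  have h53 := incommensurable_log p5 p3 (by norm_num)
  obtain ⟨R, hR, hav⟩ := exists_tendsto_avoidsPoles
    ![Real.log (2 : ℕ), Real.log (3 : ℕ), Real.log (5 : ℕ)]
    (fun i => by fin_cases i; exacts [h2, h3, h5])
    (fun i => by fin_cases i; exacts [h2le, h3le, h5le])
  have hR2 : AvoidsPoles R (Real.log (2 : ℕ)) := hav 0
  have hR3 : AvoidsPoles R (Real.log (3 : ℕ)) := hav 1
  have hR5 : AvoidsPoles R (Real.log (5 : ℕ)) := hav 2
  refine ⟨R, hR, fun x hx => ?_⟩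
  have hu : 0 ≤ Real.log x := Real.log_nonneg hx
  obtain ⟨C₂₃, hC₂₃⟩ := exists_tendsto_cosPairSum h2 h3 h23 h32 hx hR hR2 hR3
  obtain ⟨C₃₅, hC₃₅⟩ := exists_tendsto_cosPairSum h3 h5 h35 h53 hx hR hR3 hR5
  obtain ⟨C₅₂, hC₅₂⟩ := exists_tendsto_cosPairSum h5 h2 h52 h25 hx hR hR5 hR2
  -- The linear part of the one-factor sum is u/a + 1/2; removing it from the weighted count leaves
  -- the sawtooth.
  have hone : ∀ a : ℕ, 0 < Real.log a → AvoidsPoles R (Real.log a) →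
      Tendsto (fun j => oneSum (Real.log a) (Real.log x + Real.log a / 2) (R j) -
        (Real.log x + Real.log a / 2) / Real.log a) atTop
        (𝓝 (-bernoulliOneStar (Real.log x / Real.log a))) := fun a ha hRa => by
    have h := (tendsto_oneSum ha hu hR hRa).sub_const
      ((Real.log x + Real.log a / 2) / Real.log a)
    rw [oneCount_eq ha hu] at h
    convert h using 2
    field_simp
    ring
  have hthree := tendsto_threeSum h2 h3 h5 h23 h32 h25 h52 h35 h53 hu hR hR2 hR3 hR5
  set v := Real.log x + (Real.log (2 : ℕ) + Real.log (3 : ℕ) + Real.log (5 : ℕ)) / 2 with hv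
  -- Solve `threeSum_eq` for the sine series: up to the factor 1/(8π) it is a combination of
  -- quantities already known to converge, so D is defined by this limit and the formula is read off
  -- from it.
  have hlim := (((((((tendsto_const_nhds (x := (v ^ 3 / 6 -
    v * (Real.log (2 : ℕ) ^ 2 + Real.log (3 : ℕ) ^ 2 + Real.log (5 : ℕ) ^ 2) / 24) /
    (Real.log (2 : ℕ) * Real.log (3 : ℕ) * Real.log (5 : ℕ)))).add (hone 2 h2 hR2)).add
    (hone 3 h3 hR3)).add (hone 5 h5 hR5)).sub (hC₂₃.const_mul (1 / (4 * Real.pi)))).sub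
    (hC₃₅.const_mul (1 / (4 * Real.pi)))).sub (hC₅₂.const_mul (1 / (4 * Real.pi)))).sub hthree
  have hp := Real.pi_ne_zero
  refine ⟨C₂₃, C₃₅, C₅₂, _, hC₂₃, hC₃₅, hC₅₂,
    (hlim.const_mul (8 * Real.pi)).congr fun j => ?_, ?_⟩
  · rw [threeSum_eq h2 h3 h5 h23 h32 h25 h52 h35 h53 hv]
    field_simp
    ring
  · simp only [Nat.cast_ofNat] at hv h2 h3 h5 ⊢
    rw [threeCount_eq hx, hv]
    field_simp
    ring
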